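/- A finite-dimensional Hamiltonian $H$ is a Hermitian operator on $\mathbb C^d$, $d\ge 1$. For $e\in\mathbb R$ let $[e]_H$ be the set of density matrices $\rho$ on $\mathbb C^d$ with $\mathrm{Tr}(\rho H)=e$. For $\beta\in\mathbb R$ let $e_\beta(H)=\mathrm{Tr}(e^{-\beta H}H)/\mathrm{Tr}(e^{-\beta H})$, and let $e_{+\infty}(H)$ and $e_{-\infty}(H)$ be the smallest and the largest eigenvalue of $H$ (the limits $\beta\to\pm\infty$). Let $f$ assign to every finite-dimensional Hamiltonian $K$ a mean energy $f(K)$ such that $[f(K)]_K\neq\emptyset$. An environment is a finite family of systems with Hamiltonians $H_{E^1},\dots,H_{E^N}$ (of arbitrary finite dimensions, $N$ arbitrary) with total Hamiltonian $H_E=\sum_i H_{E^i}$; its compatible microstates are the states $\sigma=\sigma_1\otimes\cdots\otimes\sigma_N$ with $\sigma_i\in[f(H_{E^i})]_{H_{E^i}}$ for all $i$. * We say that work $W$ can be extracted from the environment if there are an environment and a unitary $U$ on it such that $\mathrm{Tr}(\sigma H_E)-\mathrm{Tr}(U\sigma U^\dagger H_E)\ge W$ for all compatible microstates $\sigma$.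 * For a macrostate $(e,H)$ and a density matrix $\rho_f$ on the same space we write $(e,H)\to\rho_f$ (reachable by macrostate operations) if for all $\epsilon,\epsilon'>0$ there are an environment and a unitary $U$ on system and environment such that for all $\rho\in[e]_H$ and all compatible microstates $\sigma$ of the environment $$\big\|\mathrm{Tr}_E\big(U(\rho\otimes\sigma)U^\dagger\big)-\rho_f\big\|_1\le\epsilon,\qquad \big|\mathrm{Tr}\big(U(\rho\otimes\sigma)U^\dagger H_{SE}\big)-\mathrm{Tr}\big((\rho\otimes\sigma)H_{SE}\big)\big|\le\epsilon',$$ where $H_{SE}=H\otimes 1+1\otimes H_E$. Then the thermal assignments are the only non-trivial ones: 1. If there is no fixed $\beta\in[-\infty,+\infty]$ with $f(H)=e_\beta(H)$ for all $H$, then (i) every amount of work $W\in\mathbb R$ can be extracted from the environment, and (ii) every transition is possible: $(e,H)\to\rho$ for all $H$, all $e\in\mathbb R$ and all density matrices $\rho$. 2. Conversely, if $f(H)=e_\beta(H)$ for all $H$, with a fixed $\beta\in[-\infty,+\infty]$, then not every transition is possible, and if $\beta\ge 0$, then no work $W>0$ can be extracted from the environment. -/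

import Mathlib

open scoped Matrix Kronecker ComplexOrder

noncomputable section

namespace Thermo

/-- A finite-dimensional quantum system with a Hamiltonian: a Hermitian operator on `ℂ^dim`,
with `0 < dim`. -/
structure Hamiltonian where
  dim : ℕ
  dim_pos : 0 < dim
  op : Matrix (Fin dim) (Fin dim) ℂ
  isHermitian : op.IsHermitian

/-- Density matrices. -/
def IsDensity {ι : Type*} [Fintype ι] (ρ : Matrix ι ι ℂ) : Prop :=
  ρ.PosSemidef ∧ ρ.trace = 1

/-- The mean energy `Tr(ρ H)`. -/
def meanEnergy {ι : Type*} [Fintype ι] (ρ H : Matrix ι ι ℂ) : ℝ :=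
  (ρ * H).trace.re

/-- The trace norm `‖A‖₁ = Tr √(A† A)`, the sum of the singular values of `A`. -/
def traceNorm {ι : Type*} [Fintype ι] [DecidableEq ι] (A : Matrix ι ι ℂ) : ℝ :=
  ∑ i, Real.sqrt ((Matrix.isHermitian_conjTranspose_mul_self A).eigenvalues i)

/-- The equivalence class `[e]_H` of microstates compatible with the macrostate `(e, H)`. -/
def microstates (e : ℝ) (H : Hamiltonian) : Set (Matrix (Fin H.dim) (Fin H.dim) ℂ) :=
  {ρ | IsDensity ρ ∧ meanEnergy ρ H.op = e}

/-- The canonical ensemble `exp(-βH) / Tr exp(-βH)`. -/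
def gibbsState (β : ℝ) (H : Hamiltonian) : Matrix (Fin H.dim) (Fin H.dim) ℂ :=
  (NormedSpace.exp (-(β : ℂ) • H.op)).trace⁻¹ • NormedSpace.exp (-(β : ℂ) • H.op)

/-- The smallest eigenvalue of `H`. -/
def groundEnergy (H : Hamiltonian) : ℝ := ⨅ i, H.isHermitian.eigenvalues i

/-- The largest eigenvalue of `H`. -/
def topEnergy (H : Hamiltonian) : ℝ := ⨆ i, H.isHermitian.eigenvalues i

/-- The thermal energy `e_β(H) = Tr(γ_β(H) H)` for `β ∈ ℝ`, extended to `β = ±∞` by its limits: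
the smallest eigenvalue at `β = +∞` and the largest one at `β = -∞`. -/
def thermalEnergy (β : EReal) (H : Hamiltonian) : ℝ :=
  if β = ⊤ then groundEnergy H
  else if β = ⊥ then topEnergy H
  else meanEnergy (gibbsState β.toReal H) H.op

/-- Index set of the product basis of an environment made of the systems `E 0, …, E (N-1)`. -/
abbrev EnvIdx {N : ℕ} (E : Fin N → Hamiltonian) : Type := ∀ i, Fin (E i).dim

/-- The tensor product `A₀ ⊗ ⋯ ⊗ A_{N-1}`. -/
def tensor {N : ℕ} {E : Fin N → Hamiltonian}
    (A : ∀ i, Matrix (Fin (E i).dim) (Fin (E i).dim) ℂ) :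
    Matrix (EnvIdx E) (EnvIdx E) ℂ :=
  Matrix.of fun x y => ∏ i, A i (x i) (y i)

/-- The non-interacting environment Hamiltonian `∑ᵢ 1 ⊗ ⋯ ⊗ Hᵢ ⊗ ⋯ ⊗ 1`. -/
def envHamiltonian {N : ℕ} (E : Fin N → Hamiltonian) : Matrix (EnvIdx E) (EnvIdx E) ℂ :=
  ∑ i, tensor (Function.update
    (fun j => (1 : Matrix (Fin (E j).dim) (Fin (E j).dim) ℂ)) i (E i).op)

/-- The Hamiltonian `H_S ⊗ 1 + 1 ⊗ H_E` of the compound of system and environment. -/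
def totalHamiltonian (S : Hamiltonian) {N : ℕ} (E : Fin N → Hamiltonian) :
    Matrix (Fin S.dim × EnvIdx E) (Fin S.dim × EnvIdx E) ℂ :=
  S.op ⊗ₖ (1 : Matrix (EnvIdx E) (EnvIdx E) ℂ) +
    (1 : Matrix (Fin S.dim) (Fin S.dim) ℂ) ⊗ₖ envHamiltonian E

/-- The partial trace over the second tensor factor. -/
def traceEnv {ι κ : Type*} [Fintype κ] (M : Matrix (ι × κ) (ι × κ) ℂ) : Matrix ι ι ℂ :=
  Matrix.of fun a b => ∑ x, M (a, x) (b, x)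

/-- `(e, H) → ρf` by macrostate operations, when an environment system with Hamiltonian `K` is
assigned the macrostate `(f K, K)`. The same environment and the same unitary have to work for all
microstates of the system and of the environment systems that are compatible with the
macrostates. -/
def MacroReachable (f : Hamiltonian → ℝ) (e : ℝ) (H : Hamiltonian)
    (ρf : Matrix (Fin H.dim) (Fin H.dim) ℂ) : Prop :=
  ∀ ε : ℝ, 0 < ε → ∀ ε' : ℝ, 0 < ε' → ∃ (N : ℕ) (E : Fin N → Hamiltonian),
    ∃ U ∈ Matrix.unitaryGroup (Fin H.dim × EnvIdx E) ℂ,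
      ∀ ρ ∈ microstates e H, ∀ σ : ∀ i, Matrix (Fin (E i).dim) (Fin (E i).dim) ℂ,
        (∀ i, σ i ∈ microstates (f (E i)) (E i)) →
          traceNorm (traceEnv (U * (ρ ⊗ₖ tensor σ) * Uᴴ) - ρf) ≤ ε ∧
          |meanEnergy (U * (ρ ⊗ₖ tensor σ) * Uᴴ) (totalHamiltonian H E) -
            meanEnergy (ρ ⊗ₖ tensor σ) (totalHamiltonian H E)| ≤ ε'

/-- At least the amount `W` of work can be extracted from the environment alone: some unitary on
some environment lowers the mean energy by at least `W`, for all the microstates that are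
compatible with the environment macrostates `(f K, K)`. -/
def WorkExtractable (f : Hamiltonian → ℝ) (W : ℝ) : Prop :=
  ∃ (N : ℕ) (E : Fin N → Hamiltonian), ∃ U ∈ Matrix.unitaryGroup (EnvIdx E) ℂ,
    ∀ σ : ∀ i, Matrix (Fin (E i).dim) (Fin (E i).dim) ℂ,
      (∀ i, σ i ∈ microstates (f (E i)) (E i)) →
        W ≤ meanEnergy (tensor σ) (envHamiltonian E) -
          meanEnergy (U * tensor σ * Uᴴ) (envHamiltonian E)

/-- Macrostate operations are trivial: every transition is possible. -/
def EveryTransitionPossible (f : Hamiltonian → ℝ) : Prop :=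
  ∀ (e : ℝ) (H : Hamiltonian) (ρ : Matrix (Fin H.dim) (Fin H.dim) ℂ),
    IsDensity ρ → MacroReachable f e H ρ

end Thermo

end

/-!
In the thermal case, let first `β` be finite. By the Gibbs variational principle, applied to the
joint Gibbs state of system and environment, a unitary that conserves the total energy leaves the
system close to its Gibbs state, so not every target can be reached; and no work can be extracted
since Gibbs states with `0 ≤ β` are passive. At `β = ±∞` the environment is already at the end of
its energy range: it can only absorb, or only release, energy.

If `f` is not thermal, some systems `K i` have no common inverse temperature that gives them the
mean energies `f (K i)`. The entropy compatible with these energies is then smaller than the thermal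
entropy at the same total energy. By concentration, `N` copies have exponentially fewer typical
configurations than there are Gibbs configurations of about the same energy, so there is an
injection from pairs (system state, typical configuration) to Gibbs configurations, which can be
chosen to shift the energy by any fixed amount: a battery of systems with a small gap makes up for
the fluctuations. The corresponding unitary moves whatever is in the system into the environment,
and prepares the target state. It depends on the microstates only through the total weight of the
nontypical configurations, which is exponentially small by Hoeffding's inequality.
-/

noncomputable section

namespace Thermo

section Eigenbasis

/-- The transition probabilities `|Uᵢⱼ|²` of a unitary matrix `U`. -/
def transitionMatrix {ι : Type*} (U : Matrix ι ι ℂ) : Matrix ι ι ℝ :=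
  Matrix.of fun i j => ‖U i j‖ ^ 2

variable {ι : Type*} [Fintype ι] {U V ρ : Matrix ι ι ℂ}

/-- The outcome probabilities of a measurement of the state `ρ` in the orthonormal basis formed by
the columns of a unitary matrix `V`. -/
def population (V ρ : Matrix ι ι ℂ) (i : ι) : ℝ :=
  ((Vᴴ * ρ * V) i i).re

lemma IsDensity.population_nonneg (hρ : IsDensity ρ) (V : Matrix ι ι ℂ) (i : ι) :
    0 ≤ population V ρ i :=
  (Complex.nonneg_iff.1 (hρ.1.conjTranspose_mul_mul_same V).diag_nonneg).1

lemma IsDensity.population_eq (hρ : IsDensity ρ) (V : Matrix ι ι ℂ) (i : ι) :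
    (Vᴴ * ρ * V) i i = (population V ρ i : ℂ) :=
  Complex.eq_re_of_ofReal_le (hρ.1.conjTranspose_mul_mul_same V).diag_nonneg

variable [DecidableEq ι]

/-- The operator with eigenvalues `l` in the orthonormal basis formed by the columns of a unitary
matrix `V`. Hamiltonians and states that are diagonal in a common basis are written this way. -/
def diagonalIn (V : Matrix ι ι ℂ) (l : ι → ℝ) : Matrix ι ι ℂ :=
  V * Matrix.diagonal (fun i => (l i : ℂ)) * Vᴴ

lemma conjTranspose_mul_self_of_unitary (hU : U ∈ Matrix.unitaryGroup ι ℂ) : Uᴴ * U = 1 :=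
  Matrix.mem_unitaryGroup_iff'.1 hU

lemma mul_conjTranspose_self_of_unitary (hU : U ∈ Matrix.unitaryGroup ι ℂ) : U * Uᴴ = 1 :=
  Matrix.mem_unitaryGroup_iff.1 hU

lemma conjTranspose_mem_unitaryGroup (hU : U ∈ Matrix.unitaryGroup ι ℂ) :
    Uᴴ ∈ Matrix.unitaryGroup ι ℂ :=
  Unitary.star_mem hU

lemma conj_diagonalIn (U V : Matrix ι ι ℂ) (l : ι → ℝ) :
    U * diagonalIn V l * Uᴴ = diagonalIn (U * V) l := by
  simp only [diagonalIn, Matrix.conjTranspose_mul, mul_assoc]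

lemma diagonalIn_add (V : Matrix ι ι ℂ) (l k : ι → ℝ) :
    diagonalIn V (l + k) = diagonalIn V l + diagonalIn V k := by
  simp only [diagonalIn, ← add_mul, ← mul_add, Matrix.diagonal_add, Pi.add_apply,
    Complex.ofReal_add]

lemma sum_diagonalIn {κ : Type*} (s : Finset κ) (V : Matrix ι ι ℂ) (l : κ → ι → ℝ) :
    ∑ k ∈ s, diagonalIn V (l k) = diagonalIn V (∑ k ∈ s, l k) := by
  simp only [diagonalIn, ← Finset.sum_mul, ← Finset.mul_sum]
  congr 2
  ext i j
  rcases eq_or_ne i j with rfl | hij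
  · simp [Matrix.sum_apply]
  · simp [Matrix.sum_apply, hij]

lemma trace_diagonalIn (hV : V ∈ Matrix.unitaryGroup ι ℂ) (l : ι → ℝ) :
    (diagonalIn V l).trace = ((∑ i, l i : ℝ) : ℂ) := by
  rw [diagonalIn, Matrix.trace_mul_cycle, conjTranspose_mul_self_of_unitary hV, one_mul,
    Matrix.trace_diagonal, Complex.ofReal_sum]

lemma isDensity_diagonalIn (hV : V ∈ Matrix.unitaryGroup ι ℂ) {p : ι → ℝ} (hp : ∀ i, 0 ≤ p i)
    (hp_sum : ∑ i, p i = 1) : IsDensity (diagonalIn V p) := by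
  refine ⟨(Matrix.PosSemidef.diagonal fun i => ?_).mul_mul_conjTranspose_same V, ?_⟩
  · simpa using hp i
  · rw [trace_diagonalIn hV, hp_sum, Complex.ofReal_one]

lemma IsDensity.conj (hρ : IsDensity ρ) (hU : U ∈ Matrix.unitaryGroup ι ℂ) :
    IsDensity (U * ρ * Uᴴ) := by
  refine ⟨hρ.1.mul_mul_conjTranspose_same U, ?_⟩
  rw [Matrix.trace_mul_cycle, conjTranspose_mul_self_of_unitary hU, one_mul, hρ.2]

lemma IsDensity.conjTranspose_conj (hρ : IsDensity ρ) (hU : U ∈ Matrix.unitaryGroup ι ℂ) :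
    IsDensity (Uᴴ * ρ * U) := by
  simpa using hρ.conj (conjTranspose_mem_unitaryGroup hU)

lemma IsDensity.sum_population (hρ : IsDensity ρ) (hV : V ∈ Matrix.unitaryGroup ι ℂ) :
    ∑ i, population V ρ i = 1 := by
  have h_trace := (hρ.conjTranspose_conj hV).2
  simpa [Matrix.trace, population] using congrArg Complex.re h_trace

lemma population_diagonalIn (V W : Matrix ι ι ℂ) (p : ι → ℝ) :
    population V (diagonalIn W p) = transitionMatrix (Vᴴ * W) *ᵥ p := by
  have h_conj : Vᴴ * diagonalIn W p * V = diagonalIn (Vᴴ * W) p := by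
    simpa using conj_diagonalIn Vᴴ W p
  ext i
  rw [population, h_conj, diagonalIn, Matrix.mul_apply, Complex.re_sum]
  refine Finset.sum_congr rfl fun j _ => ?_
  rw [Matrix.mul_diagonal, Matrix.conjTranspose_apply, mul_right_comm, Complex.star_def,
    Complex.mul_conj', ← Complex.ofReal_pow, ← Complex.ofReal_mul, Complex.ofReal_re]
  rfl

lemma population_diagonalIn_self (hV : V ∈ Matrix.unitaryGroup ι ℂ) (p : ι → ℝ) :
    population V (diagonalIn V p) = p := by
  have h_one : transitionMatrix (1 : Matrix ι ι ℂ) = 1 := by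
    ext i j
    rcases eq_or_ne i j with rfl | hij
    · simp [transitionMatrix]
    · simp [transitionMatrix, hij]
  rw [population_diagonalIn, conjTranspose_mul_self_of_unitary hV, h_one, Matrix.one_mulVec]

lemma meanEnergy_diagonalIn (ρ V : Matrix ι ι ℂ) (l : ι → ℝ) :
    meanEnergy ρ (diagonalIn V l) = ∑ i, population V ρ i * l i := by
  rw [meanEnergy, diagonalIn, ← mul_assoc, ← mul_assoc, Matrix.trace_mul_comm, ← mul_assoc,
    ← mul_assoc]
  simp [Matrix.trace, population]

lemma IsDensity.meanEnergy_diagonalIn_le (hρ : IsDensity ρ) (hV : V ∈ Matrix.unitaryGroup ι ℂ)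
    {l : ι → ℝ} {c : ℝ} (hl : ∀ i, l i ≤ c) : meanEnergy ρ (diagonalIn V l) ≤ c := by
  calc meanEnergy ρ (diagonalIn V l) = ∑ i, population V ρ i * l i := meanEnergy_diagonalIn ρ V l
    _ ≤ ∑ i, population V ρ i * c := by
        gcongr with i
        · exact hρ.population_nonneg V i
        · exact hl i
    _ = c := by rw [← Finset.sum_mul, hρ.sum_population hV, one_mul]

lemma IsDensity.le_meanEnergy_diagonalIn (hρ : IsDensity ρ) (hV : V ∈ Matrix.unitaryGroup ι ℂ)
    {l : ι → ℝ} {c : ℝ} (hl : ∀ i, c ≤ l i) : c ≤ meanEnergy ρ (diagonalIn V l) := by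
  calc c = ∑ i, population V ρ i * c := by rw [← Finset.sum_mul, hρ.sum_population hV, one_mul]
    _ ≤ ∑ i, population V ρ i * l i := by
        gcongr with i
        · exact hρ.population_nonneg V i
        · exact hl i
    _ = meanEnergy ρ (diagonalIn V l) := (meanEnergy_diagonalIn ρ V l).symm

lemma transitionMatrix_mem_doublyStochastic (hU : U ∈ Matrix.unitaryGroup ι ℂ) :
    transitionMatrix U ∈ doublyStochastic ℝ ι := by
  have sum_row {W : Matrix ι ι ℂ} (hW : W ∈ Matrix.unitaryGroup ι ℂ) (i : ι) :
      ∑ j, ‖W i j‖ ^ 2 = 1 := by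
    have h_entry := congrFun (congrFun (mul_conjTranspose_self_of_unitary hW) i) i
    simp only [Matrix.mul_apply, Matrix.conjTranspose_apply, Complex.star_def, Complex.mul_conj',
      Matrix.one_apply_eq] at h_entry
    exact_mod_cast h_entry
  refine mem_doublyStochastic_iff_sum.2 ⟨fun i j => by simp [transitionMatrix], sum_row hU, ?_⟩
  simpa [transitionMatrix] using sum_row (conjTranspose_mem_unitaryGroup hU)

lemma exists_doublyStochastic_population (hU : U ∈ Matrix.unitaryGroup ι ℂ)
    (hV : V ∈ Matrix.unitaryGroup ι ℂ) :
    ∃ D ∈ doublyStochastic ℝ ι, ∀ p : ι → ℝ,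
      population V (U * diagonalIn V p * Uᴴ) = D *ᵥ p :=
  ⟨transitionMatrix (Vᴴ * (U * V)), transitionMatrix_mem_doublyStochastic
    (mul_mem (conjTranspose_mem_unitaryGroup hV) (mul_mem hU hV)),
    fun p => by rw [conj_diagonalIn, population_diagonalIn]⟩

end Eigenbasis

namespace Hamiltonian

variable (H : Hamiltonian)

instance : Nonempty (Fin H.dim) := ⟨⟨0, H.dim_pos⟩⟩

/-- The eigenvalues of a Hamiltonian, listed with multiplicity. -/
def levels : Fin H.dim → ℝ := H.isHermitian.eigenvalues

/-- A unitary matrix whose columns are eigenvectors of `H` for the eigenvalues `H.levels`. -/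
def eigenbasis : Matrix (Fin H.dim) (Fin H.dim) ℂ := H.isHermitian.eigenvectorUnitary

lemma eigenbasis_mem_unitaryGroup : H.eigenbasis ∈ Matrix.unitaryGroup (Fin H.dim) ℂ :=
  H.isHermitian.eigenvectorUnitary.2

lemma op_eq_diagonalIn : H.op = diagonalIn H.eigenbasis H.levels := by
  conv_lhs => rw [H.isHermitian.spectral_theorem, Unitary.conjStarAlgAut_apply]
  rfl

lemma groundEnergy_le_levels (i : Fin H.dim) : groundEnergy H ≤ H.levels i :=
  ciInf_le (Set.finite_range _).bddBelow i

lemma levels_le_topEnergy (i : Fin H.dim) : H.levels i ≤ topEnergy H :=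
  le_ciSup (Set.finite_range _).bddAbove i

lemma exists_levels_eq_groundEnergy : ∃ i, H.levels i = groundEnergy H :=
  exists_eq_ciInf_of_finite

lemma exists_levels_eq_topEnergy : ∃ i, H.levels i = topEnergy H :=
  exists_eq_ciSup_of_finite

end Hamiltonian

section Tensor

variable {N : ℕ} {E : Fin N → Hamiltonian}

lemma tensor_mul (A B : ∀ i, Matrix (Fin (E i).dim) (Fin (E i).dim) ℂ) :
    tensor A * tensor B = tensor (fun i => A i * B i) := by
  ext x y
  simp only [tensor, Matrix.mul_apply, Matrix.of_apply, ← Finset.prod_mul_distrib]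
  rw [Finset.prod_univ_sum, Fintype.piFinset_univ]

lemma tensor_conjTranspose (A : ∀ i, Matrix (Fin (E i).dim) (Fin (E i).dim) ℂ) :
    (tensor A)ᴴ = tensor (fun i => (A i)ᴴ) := by
  ext x y
  simp [tensor, Matrix.conjTranspose_apply]

lemma tensor_diagonal (d : ∀ i, Fin (E i).dim → ℂ) :
    tensor (fun i => Matrix.diagonal (d i)) =
      Matrix.diagonal (fun x : EnvIdx E => ∏ i, d i (x i)) := by
  ext x y
  rcases eq_or_ne x y with rfl | hxy
  · simp [tensor]
  · obtain ⟨i, hi⟩ := Function.ne_iff.1 hxy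
    rw [Matrix.diagonal_apply_ne _ hxy]
    exact Finset.prod_eq_zero (Finset.mem_univ i) (Matrix.diagonal_apply_ne _ hi)

lemma tensor_one :
    tensor (fun i => (1 : Matrix (Fin (E i).dim) (Fin (E i).dim) ℂ)) = 1 := by
  simp only [← Matrix.diagonal_one]
  rw [tensor_diagonal]
  simp

lemma tensor_diagonalIn (V : ∀ i, Matrix (Fin (E i).dim) (Fin (E i).dim) ℂ)
    (l : ∀ i, Fin (E i).dim → ℝ) :
    tensor (fun i => diagonalIn (V i) (l i)) = diagonalIn (tensor V) (fun x => ∏ i, l i (x i)) := by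
  simp only [diagonalIn, tensor_conjTranspose, Complex.ofReal_prod]
  rw [← tensor_diagonal (fun i a => (l i a : ℂ)), tensor_mul, tensor_mul]

lemma trace_tensor (A : ∀ i, Matrix (Fin (E i).dim) (Fin (E i).dim) ℂ) :
    (tensor A).trace = ∏ i, (A i).trace := by
  simp only [Matrix.trace, Matrix.diag_apply]
  rw [Finset.prod_univ_sum, Fintype.piFinset_univ]
  rfl

lemma tensor_mem_unitaryGroup {V : ∀ i, Matrix (Fin (E i).dim) (Fin (E i).dim) ℂ}
    (hV : ∀ i, V i ∈ Matrix.unitaryGroup (Fin (E i).dim) ℂ) :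
    tensor V ∈ Matrix.unitaryGroup (EnvIdx E) ℂ := by
  rw [Matrix.mem_unitaryGroup_iff, Matrix.star_eq_conjTranspose, tensor_conjTranspose, tensor_mul,
    ← tensor_one]
  exact congrArg _ (funext fun i => mul_conjTranspose_self_of_unitary (hV i))

open scoped MatrixOrder Matrix.Norms.L2Operator in
lemma tensor_posSemidef {A : ∀ i, Matrix (Fin (E i).dim) (Fin (E i).dim) ℂ}
    (hA : ∀ i, (A i).PosSemidef) : (tensor A).PosSemidef := by
  choose B hB using fun i => CStarAlgebra.nonneg_iff_eq_star_mul_self.1 (hA i).nonneg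
  have h_square : tensor A = (tensor B)ᴴ * tensor B := by
    rw [tensor_conjTranspose, tensor_mul]
    exact congrArg _ (funext hB)
  exact h_square ▸ Matrix.posSemidef_conjTranspose_mul_self _

lemma IsDensity.tensor {σ : ∀ i, Matrix (Fin (E i).dim) (Fin (E i).dim) ℂ}
    (hσ : ∀ i, IsDensity (σ i)) : IsDensity (tensor σ) := by
  refine ⟨tensor_posSemidef fun i => (hσ i).1, ?_⟩
  rw [trace_tensor]
  exact Finset.prod_eq_one fun i _ => (hσ i).2

lemma population_tensor (V : ∀ i, Matrix (Fin (E i).dim) (Fin (E i).dim) ℂ)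
    {σ : ∀ i, Matrix (Fin (E i).dim) (Fin (E i).dim) ℂ} (hσ : ∀ i, IsDensity (σ i))
    (x : EnvIdx E) :
    population (tensor V) (tensor σ) x = ∏ i, population (V i) (σ i) (x i) := by
  rw [population, tensor_conjTranspose, tensor_mul, tensor_mul, tensor, Matrix.of_apply,
    Finset.prod_congr rfl fun i _ => (hσ i).population_eq (V i) (x i),
    ← Complex.ofReal_prod, Complex.ofReal_re]

end Tensor

section Environment

variable {N : ℕ} (E : Fin N → Hamiltonian)

/-- The product of the eigenbases of the environment systems. -/
def envBasis : Matrix (EnvIdx E) (EnvIdx E) ℂ :=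
  tensor fun i => (E i).eigenbasis

/-- The energies of the product states `envBasis E`. -/
def envEnergy (x : EnvIdx E) : ℝ :=
  ∑ i, (E i).levels (x i)

lemma envBasis_mem_unitaryGroup : envBasis E ∈ Matrix.unitaryGroup (EnvIdx E) ℂ :=
  tensor_mem_unitaryGroup fun i => (E i).eigenbasis_mem_unitaryGroup

lemma tensor_update_one_op (i : Fin N) :
    tensor (Function.update
      (fun j => (1 : Matrix (Fin (E j).dim) (Fin (E j).dim) ℂ)) i (E i).op) =
      diagonalIn (envBasis E) (fun x => (E i).levels (x i)) := by
  have h_factor : Function.update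
      (fun j => (1 : Matrix (Fin (E j).dim) (Fin (E j).dim) ℂ)) i (E i).op =
      fun j => diagonalIn (E j).eigenbasis
        (Function.update (fun (j : Fin N) (_ : Fin (E j).dim) => (1 : ℝ)) i (E i).levels j) := by
    ext1 j
    rcases eq_or_ne j i with rfl | hji
    · simp [(E j).op_eq_diagonalIn]
    · simp [hji, diagonalIn, mul_conjTranspose_self_of_unitary (E j).eigenbasis_mem_unitaryGroup]
  rw [h_factor, tensor_diagonalIn]
  congr 1
  ext x
  rw [Finset.prod_eq_single i (fun j _ hji => by simp [hji]) (by simp)]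
  simp

lemma envHamiltonian_eq_diagonalIn : envHamiltonian E = diagonalIn (envBasis E) (envEnergy E) := by
  simp only [envHamiltonian, tensor_update_one_op, sum_diagonalIn]
  congr 1
  ext x
  simp [envEnergy]

lemma meanEnergy_tensor {σ : ∀ i, Matrix (Fin (E i).dim) (Fin (E i).dim) ℂ}
    (hσ : ∀ i, IsDensity (σ i)) :
    meanEnergy (tensor σ) (envHamiltonian E) = ∑ i, meanEnergy (σ i) (E i).op := by
  simp only [meanEnergy, envHamiltonian, Finset.mul_sum, Matrix.trace_sum, Complex.re_sum]
  refine Finset.sum_congr rfl fun i _ => ?_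
  rw [tensor_mul, trace_tensor,
    Finset.prod_eq_single i (fun j _ hji => by simp [hji, (hσ j).2]) (by simp)]
  simp

lemma sum_groundEnergy_le_envEnergy (x : EnvIdx E) : ∑ i, groundEnergy (E i) ≤ envEnergy E x :=
  Finset.sum_le_sum fun i _ => (E i).groundEnergy_le_levels (x i)

lemma envEnergy_le_sum_topEnergy (x : EnvIdx E) : envEnergy E x ≤ ∑ i, topEnergy (E i) :=
  Finset.sum_le_sum fun i _ => (E i).levels_le_topEnergy (x i)

end Environment

section TraceNorm

variable {ι : Type*} [Fintype ι]

lemma abs_meanEnergy_le {A H : Matrix ι ι ℂ} {c : ℝ} (hA : ∀ a b, ‖A a b‖ ≤ c) :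
    |meanEnergy A H| ≤ c * ∑ a, ∑ b, ‖H b a‖ := by
  calc |meanEnergy A H| ≤ ‖∑ a, ∑ b, A a b * H b a‖ := Complex.abs_re_le_norm _
    _ ≤ ∑ a, ∑ b, ‖A a b‖ * ‖H b a‖ := by
        refine (norm_sum_le _ _).trans (Finset.sum_le_sum fun a _ => ?_)
        exact (norm_sum_le _ _).trans (Finset.sum_le_sum fun b _ => norm_mul_le _ _)
    _ ≤ ∑ a, ∑ b, c * ‖H b a‖ := by
        gcongr with a _ b _
        exact hA a b
    _ = c * ∑ a, ∑ b, ‖H b a‖ := by simp only [Finset.mul_sum]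

variable [DecidableEq ι]

lemma traceNorm_nonneg (A : Matrix ι ι ℂ) : 0 ≤ traceNorm A :=
  Finset.sum_nonneg fun _ _ => Real.sqrt_nonneg _

lemma sum_eigenvalues_conjTranspose_mul_self (A : Matrix ι ι ℂ) :
    ∑ i, (Matrix.isHermitian_conjTranspose_mul_self A).eigenvalues i =
      ∑ i, ∑ j, ‖A i j‖ ^ 2 := by
  have h_trace := (Matrix.isHermitian_conjTranspose_mul_self A).trace_eq_sum_eigenvalues
  simp only [Matrix.trace, Matrix.diag_apply, Matrix.mul_apply, Matrix.conjTranspose_apply,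
    Complex.star_def, Complex.conj_mul'] at h_trace
  rw [Finset.sum_comm]
  exact Complex.ofReal_injective (by push_cast; exact h_trace.symm)

lemma sum_norm_sq_le_traceNorm_sq (A : Matrix ι ι ℂ) :
    ∑ i, ∑ j, ‖A i j‖ ^ 2 ≤ traceNorm A ^ 2 := by
  calc ∑ i, ∑ j, ‖A i j‖ ^ 2
      = ∑ i, √((Matrix.isHermitian_conjTranspose_mul_self A).eigenvalues i) ^ 2 := by
        rw [← sum_eigenvalues_conjTranspose_mul_self]
        exact Finset.sum_congr rfl fun i _ => (Real.sq_sqrt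
          ((Matrix.posSemidef_conjTranspose_mul_self A).eigenvalues_nonneg i)).symm
    _ ≤ traceNorm A ^ 2 := Finset.sum_sq_le_sq_sum_of_nonneg fun i _ => Real.sqrt_nonneg _

lemma norm_entry_le_traceNorm (A : Matrix ι ι ℂ) (a b : ι) : ‖A a b‖ ≤ traceNorm A := by
  refine le_of_sq_le_sq ?_ (traceNorm_nonneg A)
  calc ‖A a b‖ ^ 2 ≤ ∑ j, ‖A a j‖ ^ 2 :=
        Finset.single_le_sum (f := fun j => ‖A a j‖ ^ 2) (fun j _ => by positivity)
          (Finset.mem_univ b)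
    _ ≤ ∑ i, ∑ j, ‖A i j‖ ^ 2 :=
        Finset.single_le_sum (f := fun i => ∑ j, ‖A i j‖ ^ 2) (fun i _ => by positivity)
          (Finset.mem_univ a)
    _ ≤ traceNorm A ^ 2 := sum_norm_sq_le_traceNorm_sq A

lemma traceNorm_le {A : Matrix ι ι ℂ} {c : ℝ} (hc : 0 ≤ c) (hA : ∀ a b, ‖A a b‖ ≤ c) :
    traceNorm A ≤ (Fintype.card ι : ℝ) ^ 2 * c := by
  have h_singular (i : ι) : √((Matrix.isHermitian_conjTranspose_mul_self A).eigenvalues i) ≤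
      Fintype.card ι * c := by
    refine Real.sqrt_le_iff.2 ⟨by positivity, ?_⟩
    calc _ ≤ ∑ i, (Matrix.isHermitian_conjTranspose_mul_self A).eigenvalues i :=
          Finset.single_le_sum (fun i _ =>
            (Matrix.posSemidef_conjTranspose_mul_self A).eigenvalues_nonneg i) (Finset.mem_univ i)
      _ = ∑ i, ∑ j, ‖A i j‖ ^ 2 := sum_eigenvalues_conjTranspose_mul_self A
      _ ≤ ∑ _i : ι, ∑ _j : ι, c ^ 2 := by
          gcongr with i _ j _
          exact hA i j
      _ = (Fintype.card ι * c) ^ 2 := by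
          simp only [Finset.sum_const, Finset.card_univ, nsmul_eq_mul]
          ring
  calc traceNorm A ≤ ∑ _i : ι, (Fintype.card ι : ℝ) * c := Finset.sum_le_sum fun i _ => h_singular i
    _ = (Fintype.card ι : ℝ) ^ 2 * c := by
        simp only [Finset.sum_const, Finset.card_univ, nsmul_eq_mul]
        ring

end TraceNorm

section PartialTrace

variable {ι κ : Type*} [Fintype ι] [Fintype κ]

lemma IsDensity.kronecker {ρ : Matrix ι ι ℂ} {σ : Matrix κ κ ℂ}
    (hρ : IsDensity ρ) (hσ : IsDensity σ) : IsDensity (ρ ⊗ₖ σ) := by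
  refine ⟨hρ.1.kronecker hσ.1, ?_⟩
  rw [Matrix.trace_kronecker, hρ.2, hσ.2, one_mul]

omit [Fintype ι] in
lemma traceEnv_kronecker (ρ : Matrix ι ι ℂ) {σ : Matrix κ κ ℂ} (hσ : σ.trace = 1) :
    traceEnv (ρ ⊗ₖ σ) = ρ := by
  ext a b
  simp only [traceEnv, Matrix.of_apply, Matrix.kroneckerMap_apply]
  rw [← Finset.mul_sum, show ∑ x, σ x x = 1 from hσ, mul_one]

lemma meanEnergy_add (ω H K : Matrix ι ι ℂ) :
    meanEnergy ω (H + K) = meanEnergy ω H + meanEnergy ω K := by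
  simp only [meanEnergy, mul_add, Matrix.trace_add, Complex.add_re]

lemma meanEnergy_sub (ρ σ H : Matrix ι ι ℂ) :
    meanEnergy (ρ - σ) H = meanEnergy ρ H - meanEnergy σ H := by
  simp only [meanEnergy, sub_mul, Matrix.trace_sub, Complex.sub_re]

lemma diagonalIn_one [DecidableEq ι] {V : Matrix ι ι ℂ} (hV : V ∈ Matrix.unitaryGroup ι ℂ) :
    diagonalIn V 1 = 1 := by
  simp [diagonalIn, mul_conjTranspose_self_of_unitary hV]

lemma meanEnergy_one_kronecker [DecidableEq ι] {ρ : Matrix ι ι ℂ} (hρ : ρ.trace = 1)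
    (σ HE : Matrix κ κ ℂ) :
    meanEnergy (ρ ⊗ₖ σ) ((1 : Matrix ι ι ℂ) ⊗ₖ HE) = meanEnergy σ HE := by
  rw [meanEnergy, ← Matrix.mul_kronecker_mul, Matrix.trace_kronecker, mul_one, hρ, one_mul,
    meanEnergy]

variable [DecidableEq κ]

lemma kronecker_diagonalIn [DecidableEq ι] (V : Matrix ι ι ℂ) (W : Matrix κ κ ℂ) (p : ι → ℝ)
    (q : κ → ℝ) :
    diagonalIn V p ⊗ₖ diagonalIn W q = diagonalIn (V ⊗ₖ W) (fun x => p x.1 * q x.2) := by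
  simp only [diagonalIn, Matrix.mul_kronecker_mul, Matrix.conjTranspose_kronecker,
    Matrix.diagonal_kronecker_diagonal, Complex.ofReal_mul]

lemma trace_traceEnv_mul (ω : Matrix (ι × κ) (ι × κ) ℂ) (A : Matrix ι ι ℂ) :
    (traceEnv ω * A).trace = (ω * A ⊗ₖ (1 : Matrix κ κ ℂ)).trace := by
  simp only [Matrix.trace, Matrix.diag_apply, Matrix.mul_apply, traceEnv, Matrix.of_apply,
    Fintype.sum_prod_type, Matrix.kroneckerMap_apply, Matrix.one_apply, mul_ite, mul_one, mul_zero,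
    Finset.sum_ite_eq', Finset.mem_univ, if_true, Finset.sum_mul]
  exact Finset.sum_congr rfl fun i _ => Finset.sum_comm

lemma traceEnv_conj_kronecker (V : Matrix ι ι ℂ) {W : Matrix κ κ ℂ}
    (hW : W ∈ Matrix.unitaryGroup κ ℂ) (ω : Matrix (ι × κ) (ι × κ) ℂ) :
    traceEnv ((V ⊗ₖ W)ᴴ * ω * (V ⊗ₖ W)) = Vᴴ * traceEnv ω * V := by
  refine Matrix.ext_iff_trace_mul_right.2 fun A => ?_
  calc (traceEnv ((V ⊗ₖ W)ᴴ * ω * (V ⊗ₖ W)) * A).trace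
      = (ω * ((V ⊗ₖ W) * A ⊗ₖ (1 : Matrix κ κ ℂ) * (V ⊗ₖ W)ᴴ)).trace := by
        rw [trace_traceEnv_mul, mul_assoc, mul_assoc, Matrix.trace_mul_comm]
        simp only [mul_assoc]
    _ = (ω * (V * A * Vᴴ) ⊗ₖ (1 : Matrix κ κ ℂ)).trace := by
        rw [Matrix.conjTranspose_kronecker, ← Matrix.mul_kronecker_mul,
          ← Matrix.mul_kronecker_mul, mul_one, mul_conjTranspose_self_of_unitary hW]
    _ = (Vᴴ * traceEnv ω * V * A).trace := by
        rw [← trace_traceEnv_mul, ← mul_assoc, Matrix.trace_mul_comm]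
        simp only [mul_assoc]

lemma population_traceEnv (V : Matrix ι ι ℂ) {W : Matrix κ κ ℂ}
    (hW : W ∈ Matrix.unitaryGroup κ ℂ) (ω : Matrix (ι × κ) (ι × κ) ℂ) (a : ι) :
    population V (traceEnv ω) a = ∑ x, population (V ⊗ₖ W) ω (a, x) := by
  rw [population, ← traceEnv_conj_kronecker V hW]
  simp only [traceEnv, Matrix.of_apply, Complex.re_sum, population]

end PartialTrace

section JointEvolution

/-- The joint state `U (ρ ⊗ σ) U†` of system and environment after the evolution `U`. -/
def jointEvolution {ι κ : Type*} [Fintype ι] [Fintype κ] (U : Matrix (ι × κ) (ι × κ) ℂ)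
    (ρ : Matrix ι ι ℂ) (σ : Matrix κ κ ℂ) : Matrix (ι × κ) (ι × κ) ℂ :=
  U * (ρ ⊗ₖ σ) * Uᴴ

/-- The gain in the mean energy of the environment when system and environment evolve by `U`. -/
def absorbedEnergy {ι : Type*} [Fintype ι] [DecidableEq ι] {N : ℕ} (E : Fin N → Hamiltonian)
    (U : Matrix (ι × EnvIdx E) (ι × EnvIdx E) ℂ) (ρ : Matrix ι ι ℂ)
    (σ : Matrix (EnvIdx E) (EnvIdx E) ℂ) : ℝ :=
  meanEnergy (jointEvolution U ρ σ) ((1 : Matrix ι ι ℂ) ⊗ₖ envHamiltonian E) -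
    meanEnergy σ (envHamiltonian E)

variable {S : Hamiltonian} {N : ℕ} {E : Fin N → Hamiltonian}

lemma IsDensity.jointEvolution {ι κ : Type*} [Fintype ι] [DecidableEq ι] [Fintype κ]
    [DecidableEq κ] {U : Matrix (ι × κ) (ι × κ) ℂ} (hU : U ∈ Matrix.unitaryGroup (ι × κ) ℂ)
    {ρ : Matrix ι ι ℂ} {σ : Matrix κ κ ℂ} (hρ : IsDensity ρ) (hσ : IsDensity σ) :
    IsDensity (jointEvolution U ρ σ) :=
  (hρ.kronecker hσ).conj hU

lemma meanEnergy_totalHamiltonian (ω : Matrix (Fin S.dim × EnvIdx E) (Fin S.dim × EnvIdx E) ℂ) :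
    meanEnergy ω (totalHamiltonian S E) = meanEnergy (traceEnv ω) S.op +
      meanEnergy ω ((1 : Matrix (Fin S.dim) (Fin S.dim) ℂ) ⊗ₖ envHamiltonian E) := by
  rw [totalHamiltonian, meanEnergy_add]
  simp only [meanEnergy, trace_traceEnv_mul]

lemma one_kronecker_envHamiltonian_eq_diagonalIn :
    (1 : Matrix (Fin S.dim) (Fin S.dim) ℂ) ⊗ₖ envHamiltonian E =
      diagonalIn (S.eigenbasis ⊗ₖ envBasis E) (fun x => envEnergy E x.2) := by
  rw [← diagonalIn_one S.eigenbasis_mem_unitaryGroup, envHamiltonian_eq_diagonalIn,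
    kronecker_diagonalIn]
  simp

lemma eigenbasis_kronecker_envBasis_mem_unitaryGroup (S : Hamiltonian) (E : Fin N → Hamiltonian) :
    S.eigenbasis ⊗ₖ envBasis E ∈ Matrix.unitaryGroup (Fin S.dim × EnvIdx E) ℂ :=
  Matrix.kronecker_mem_unitary S.eigenbasis_mem_unitaryGroup (envBasis_mem_unitaryGroup E)

lemma totalHamiltonian_eq_diagonalIn :
    totalHamiltonian S E = diagonalIn (S.eigenbasis ⊗ₖ envBasis E)
      (fun x => S.levels x.1 + envEnergy E x.2) := by
  have h_system : S.op ⊗ₖ (1 : Matrix (EnvIdx E) (EnvIdx E) ℂ) =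
      diagonalIn (S.eigenbasis ⊗ₖ envBasis E) (fun x => S.levels x.1) := by
    rw [← diagonalIn_one (envBasis_mem_unitaryGroup E), S.op_eq_diagonalIn, kronecker_diagonalIn]
    simp
  rw [totalHamiltonian, h_system, one_kronecker_envHamiltonian_eq_diagonalIn, ← diagonalIn_add]
  rfl

lemma meanEnergy_jointEvolution_sub (U : Matrix (Fin S.dim × EnvIdx E) (Fin S.dim × EnvIdx E) ℂ)
    {ρ : Matrix (Fin S.dim) (Fin S.dim) ℂ} (hρ : IsDensity ρ)
    {σ : Matrix (EnvIdx E) (EnvIdx E) ℂ} (hσ : IsDensity σ) :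
    meanEnergy (jointEvolution U ρ σ) (totalHamiltonian S E) -
        meanEnergy (ρ ⊗ₖ σ) (totalHamiltonian S E) =
      meanEnergy (traceEnv (jointEvolution U ρ σ)) S.op - meanEnergy ρ S.op +
        absorbedEnergy E U ρ σ := by
  rw [meanEnergy_totalHamiltonian, meanEnergy_totalHamiltonian, traceEnv_kronecker ρ hσ.2,
    meanEnergy_one_kronecker hρ.2, absorbedEnergy]
  ring

lemma MacroReachable.exists_unitary_meanEnergy {f : Hamiltonian → ℝ} {e : ℝ}
    {ρf : Matrix (Fin S.dim) (Fin S.dim) ℂ} (h : MacroReachable f e S ρf)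
    (A : Matrix (Fin S.dim) (Fin S.dim) ℂ) {δ : ℝ} (hδ : 0 < δ) :
    ∃ (N : ℕ) (E : Fin N → Hamiltonian), ∃ U ∈ Matrix.unitaryGroup (Fin S.dim × EnvIdx E) ℂ,
      ∀ ρ ∈ microstates e S, ∀ σ : ∀ i, Matrix (Fin (E i).dim) (Fin (E i).dim) ℂ,
        (∀ i, σ i ∈ microstates (f (E i)) (E i)) →
          |meanEnergy (traceEnv (jointEvolution U ρ (tensor σ))) A - meanEnergy ρf A| ≤ δ ∧
          |meanEnergy (jointEvolution U ρ (tensor σ)) (totalHamiltonian S E) -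
            meanEnergy (ρ ⊗ₖ tensor σ) (totalHamiltonian S E)| ≤ δ := by
  set c : ℝ := ∑ a, ∑ b, ‖A b a‖
  have hc : 0 < c + 1 := by positivity
  obtain ⟨N, E, U, hU, hE⟩ := h (δ / (c + 1)) (div_pos hδ hc) δ hδ
  refine ⟨N, E, U, hU, fun ρ hρ σ hσ => ⟨?_, (hE ρ hρ σ hσ).2⟩⟩
  rw [← meanEnergy_sub]
  calc |meanEnergy (traceEnv (jointEvolution U ρ (tensor σ)) - ρf) A| ≤ δ / (c + 1) * c :=
        abs_meanEnergy_le fun a b => (norm_entry_le_traceNorm _ a b).trans (hE ρ hρ σ hσ).1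
    _ ≤ δ := by
        rw [div_mul_eq_mul_div, div_le_iff₀ hc]
        exact mul_le_mul_of_nonneg_left (le_add_of_nonneg_right zero_le_one) hδ.le

end JointEvolution

section Gibbs

variable {ι κ : Type*} [Fintype ι] [Fintype κ]

/-- The partition function of a system with energy levels `l`. -/
def partitionFunction (l : ι → ℝ) (β : ℝ) : ℝ := ∑ i, Real.exp (-β * l i)

/-- The Gibbs distribution on the energy levels `l`. -/
def gibbsWeight (l : ι → ℝ) (β : ℝ) (i : ι) : ℝ := Real.exp (-β * l i) / partitionFunction l β

/-- The mean energy of the Gibbs distribution on the energy levels `l`. -/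
def gibbsEnergy (l : ι → ℝ) (β : ℝ) : ℝ := ∑ i, gibbsWeight l β i * l i

lemma partitionFunction_pos [Nonempty ι] (l : ι → ℝ) (β : ℝ) : 0 < partitionFunction l β :=
  Finset.sum_pos (fun _ _ => Real.exp_pos _) Finset.univ_nonempty

lemma gibbsWeight_pos [Nonempty ι] (l : ι → ℝ) (β : ℝ) (i : ι) : 0 < gibbsWeight l β i :=
  div_pos (Real.exp_pos _) (partitionFunction_pos l β)

lemma sum_gibbsWeight [Nonempty ι] (l : ι → ℝ) (β : ℝ) : ∑ i, gibbsWeight l β i = 1 := by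
  simp only [gibbsWeight]
  rw [← Finset.sum_div]
  exact div_self (partitionFunction_pos l β).ne'

lemma gibbsWeight_mul_exp (l : ι → ℝ) (β : ℝ) (i j : ι) :
    gibbsWeight l β i * Real.exp (β * (l i - l j)) = gibbsWeight l β j := by
  rw [gibbsWeight, div_mul_eq_mul_div, ← Real.exp_add, gibbsWeight]
  ring_nf

lemma antivary_gibbsWeight (l : ι → ℝ) {β : ℝ} (hβ : 0 ≤ β) : Antivary (gibbsWeight l β) l := by
  intro i j hij
  simp only [gibbsWeight]
  gcongr ?_ / _
  · exact Finset.sum_nonneg fun i _ => (Real.exp_pos _).le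
  · exact Real.exp_le_exp.2 (mul_le_mul_of_nonpos_left hij.le (neg_nonpos.2 hβ))

lemma partitionFunction_add (l : ι → ℝ) (k : κ → ℝ) (β : ℝ) :
    partitionFunction (fun x : ι × κ => l x.1 + k x.2) β =
      partitionFunction l β * partitionFunction k β := by
  simp only [partitionFunction, Fintype.sum_prod_type, mul_add, Real.exp_add, Finset.sum_mul_sum]

lemma gibbsWeight_add (l : ι → ℝ) (k : κ → ℝ) (β : ℝ) (x : ι × κ) :
    gibbsWeight (fun x : ι × κ => l x.1 + k x.2) β x =
      gibbsWeight l β x.1 * gibbsWeight k β x.2 := by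
  rw [gibbsWeight, partitionFunction_add, mul_add, Real.exp_add, mul_div_mul_comm, gibbsWeight,
    gibbsWeight]

lemma partitionFunction_pi {α : Type*} [Fintype α] [DecidableEq α] {I : α → Type*}
    [∀ a, Fintype (I a)] (l : ∀ a, I a → ℝ) (β : ℝ) :
    partitionFunction (fun x : ∀ a, I a => ∑ a, l a (x a)) β = ∏ a, partitionFunction (l a) β := by
  simp only [partitionFunction, Finset.mul_sum, Real.exp_sum]
  rw [Finset.prod_univ_sum, Fintype.piFinset_univ]

lemma gibbsWeight_pi {α : Type*} [Fintype α] [DecidableEq α] {I : α → Type*}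
    [∀ a, Fintype (I a)] (l : ∀ a, I a → ℝ) (β : ℝ) (x : ∀ a, I a) :
    gibbsWeight (fun x : ∀ a, I a => ∑ a, l a (x a)) β x = ∏ a, gibbsWeight (l a) β (x a) := by
  simp only [gibbsWeight]
  rw [partitionFunction_pi, Finset.mul_sum, Real.exp_sum, Finset.prod_div_distrib]

lemma exp_neg_smul_diagonalIn [DecidableEq ι] {V : Matrix ι ι ℂ}
    (hV : V ∈ Matrix.unitaryGroup ι ℂ) (l : ι → ℝ) (β : ℝ) :
    NormedSpace.exp (-(β : ℂ) • diagonalIn V l) = diagonalIn V (fun i => Real.exp (-β * l i)) := by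
  have h_inv : V⁻¹ = Vᴴ := Matrix.inv_eq_right_inv (mul_conjTranspose_self_of_unitary hV)
  have h_unit : IsUnit V := IsUnit.of_mul_eq_one _ (mul_conjTranspose_self_of_unitary hV)
  rw [diagonalIn, diagonalIn, ← h_inv, ← Matrix.smul_mul, ← Matrix.mul_smul,
    ← Matrix.diagonal_smul, Matrix.exp_conj _ _ h_unit, Matrix.exp_diagonal]
  congr 3
  ext i
  rw [Pi.coe_exp, ← Complex.exp_eq_exp_ℂ]
  simp

variable (H : Hamiltonian) (β : ℝ)

lemma gibbsState_eq_diagonalIn :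
    gibbsState β H = diagonalIn H.eigenbasis (gibbsWeight H.levels β) := by
  have h_exp : NormedSpace.exp (-(β : ℂ) • H.op) =
      diagonalIn H.eigenbasis (fun i => Real.exp (-β * H.levels i)) := by
    conv_lhs => rw [H.op_eq_diagonalIn]
    exact exp_neg_smul_diagonalIn H.eigenbasis_mem_unitaryGroup H.levels β
  rw [gibbsState, h_exp, trace_diagonalIn H.eigenbasis_mem_unitaryGroup, diagonalIn, diagonalIn,
    ← Matrix.smul_mul, ← Matrix.mul_smul, ← Matrix.diagonal_smul]
  congr 3
  ext i
  simp [gibbsWeight, partitionFunction, div_eq_inv_mul]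

lemma isDensity_gibbsState : IsDensity (gibbsState β H) := by
  rw [gibbsState_eq_diagonalIn]
  exact isDensity_diagonalIn H.eigenbasis_mem_unitaryGroup (fun i => (gibbsWeight_pos _ _ i).le)
    (sum_gibbsWeight _ _)

lemma thermalEnergy_top : thermalEnergy ⊤ H = groundEnergy H := by
  simp [thermalEnergy]

lemma thermalEnergy_bot : thermalEnergy ⊥ H = topEnergy H := by
  simp [thermalEnergy]

lemma thermalEnergy_coe : thermalEnergy (β : EReal) H = meanEnergy (gibbsState β H) H.op := by
  simp [thermalEnergy]

lemma thermalEnergy_coe_eq_gibbsEnergy :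
    thermalEnergy (β : EReal) H = gibbsEnergy H.levels β := by
  rw [thermalEnergy_coe, gibbsState_eq_diagonalIn]
  conv_lhs => rw [H.op_eq_diagonalIn]
  rw [meanEnergy_diagonalIn, population_diagonalIn_self H.eigenbasis_mem_unitaryGroup, gibbsEnergy]

lemma gibbsState_mem_microstates {f : Hamiltonian → ℝ} (h : ∀ K, f K = thermalEnergy β K) :
    gibbsState β H ∈ microstates (f H) H :=
  ⟨isDensity_gibbsState H β, by rw [h, thermalEnergy_coe]⟩

lemma tensor_gibbsState {N : ℕ} (E : Fin N → Hamiltonian) :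
    tensor (fun i => gibbsState β (E i)) =
      diagonalIn (envBasis E) (gibbsWeight (envEnergy E) β) := by
  simp only [gibbsState_eq_diagonalIn]
  rw [tensor_diagonalIn]
  congr 1
  ext x
  exact (gibbsWeight_pi (fun i => (E i).levels) β x).symm

lemma gibbsState_kronecker_tensor_gibbsState {N : ℕ} (E : Fin N → Hamiltonian) :
    gibbsState β H ⊗ₖ tensor (fun i => gibbsState β (E i)) =
      diagonalIn (H.eigenbasis ⊗ₖ envBasis E)
        (gibbsWeight (fun x => H.levels x.1 + envEnergy E x.2) β) := by
  rw [gibbsState_eq_diagonalIn, tensor_gibbsState, kronecker_diagonalIn]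
  exact congrArg _ (funext fun x => (gibbsWeight_add H.levels (envEnergy E) β x).symm)

end Gibbs

section Passivity

variable {ι : Type*} [Fintype ι] [DecidableEq ι] {D : Matrix ι ι ℝ}

lemma sum_mul_le_sum_mulVec_mul (hD : D ∈ doublyStochastic ℝ ι) {p l : ι → ℝ}
    (hpl : Antivary p l) : ∑ i, p i * l i ≤ ∑ i, (D *ᵥ p) i * l i := by
  obtain ⟨w, hw, hw_sum, rfl⟩ := exists_eq_sum_perm_of_mem_doublyStochastic hD
  have h_perm (π : Equiv.Perm ι) :
      ∑ i, p i * l i ≤ ∑ i, (π.permMatrix ℝ *ᵥ p) i * l i := by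
    simpa [Matrix.permMatrix_mulVec] using hpl.sum_mul_le_sum_comp_perm_mul (σ := π)
  calc ∑ i, p i * l i = ∑ π, w π * ∑ i, p i * l i := by rw [← Finset.sum_mul, hw_sum, one_mul]
    _ ≤ ∑ π, w π * ∑ i, (π.permMatrix ℝ *ᵥ p) i * l i :=
        Finset.sum_le_sum fun π _ => mul_le_mul_of_nonneg_left (h_perm π) (hw π)
    _ = ∑ i, ((∑ π, w π • π.permMatrix ℝ) *ᵥ p) i * l i := by
        simp only [Matrix.sum_mulVec, Matrix.smul_mulVec, Finset.sum_apply, Pi.smul_apply,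
          smul_eq_mul, Finset.sum_mul, Finset.mul_sum, mul_assoc]
        exact Finset.sum_comm

/- Weighting the pointwise inequality `1 - e⁻ᵗ ≤ t` by the transition probabilities `D i j` gives a
form of the Gibbs variational principle that needs no logarithms of the populations `D *ᵥ p`, which
may vanish. -/
lemma one_sub_sum_gibbsWeight_mul_exp_le [Nonempty ι] (hD : D ∈ doublyStochastic ℝ ι) (l : ι → ℝ)
    (β : ℝ) (g : ι → ℝ) :
    1 - ∑ i, gibbsWeight l β i * Real.exp (-g i) ≤
      β * (∑ i, (D *ᵥ gibbsWeight l β) i * l i - ∑ i, gibbsWeight l β i * l i) +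
        ∑ i, (D *ᵥ gibbsWeight l β) i * g i := by
  set p := gibbsWeight l β
  obtain ⟨hD_nonneg, hD_row, hD_col⟩ := mem_doublyStochastic_iff_sum.1 hD
  have h_pointwise (i j : ι) :
      p j - p i * Real.exp (-g i) ≤ p j * (β * (l i - l j) + g i) := by
    have h_exp : p i * Real.exp (-g i) = p j * Real.exp (-(β * (l i - l j) + g i)) := by
      rw [show p j = p i * Real.exp (β * (l i - l j)) from (gibbsWeight_mul_exp l β i j).symm,
        mul_assoc, ← Real.exp_add]
      ring_nf
    have h_one := Real.add_one_le_exp (-(β * (l i - l j) + g i))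
    rw [h_exp]
    nlinarith [gibbsWeight_pos l β j]
  have h_row (q : ι → ℝ) : ∑ i, ∑ j, D i j * q i = ∑ i, q i := by
    simp only [← Finset.sum_mul, hD_row, one_mul]
  have h_col (q : ι → ℝ) : ∑ i, ∑ j, D i j * q j = ∑ j, q j := by
    rw [Finset.sum_comm]
    simp only [← Finset.sum_mul, hD_col, one_mul]
  have h_mulVec (q : ι → ℝ) : ∑ i, (D *ᵥ p) i * q i = ∑ i, ∑ j, D i j * (p j * q i) := by
    simp only [Matrix.mulVec, dotProduct, Finset.sum_mul, mul_assoc]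
  calc 1 - ∑ i, p i * Real.exp (-g i)
      = ∑ i, ∑ j, D i j * (p j - p i * Real.exp (-g i)) := by
        simp only [mul_sub, Finset.sum_sub_distrib]
        rw [h_col, h_row (fun i => p i * Real.exp (-g i)), sum_gibbsWeight]
    _ ≤ ∑ i, ∑ j, D i j * (p j * (β * (l i - l j) + g i)) :=
        Finset.sum_le_sum fun i _ => Finset.sum_le_sum fun j _ =>
          mul_le_mul_of_nonneg_left (h_pointwise i j) (hD_nonneg i j)
    _ = β * (∑ i, (D *ᵥ p) i * l i - ∑ i, p i * l i) + ∑ i, (D *ᵥ p) i * g i := by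
        rw [h_mulVec, h_mulVec, ← h_col (fun j => p j * l j)]
        simp only [mul_sub, Finset.mul_sum, ← Finset.sum_sub_distrib, ← Finset.sum_add_distrib]
        exact Finset.sum_congr rfl fun i _ => Finset.sum_congr rfl fun j _ => by ring

end Passivity

section Microstates

variable {H : Hamiltonian} {e : ℝ}

lemma groundEnergy_le_of_nonempty (h : (microstates e H).Nonempty) : groundEnergy H ≤ e := by
  obtain ⟨ρ, hρ, rfl⟩ := h
  rw [H.op_eq_diagonalIn]
  exact hρ.le_meanEnergy_diagonalIn H.eigenbasis_mem_unitaryGroup H.groundEnergy_le_levels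

lemma le_topEnergy_of_nonempty (h : (microstates e H).Nonempty) : e ≤ topEnergy H := by
  obtain ⟨ρ, hρ, rfl⟩ := h
  rw [H.op_eq_diagonalIn]
  exact hρ.meanEnergy_diagonalIn_le H.eigenbasis_mem_unitaryGroup H.levels_le_topEnergy

/-- The pure state of the `i`-th energy eigenvector of `H`. -/
def eigenstate (H : Hamiltonian) (i : Fin H.dim) : Matrix (Fin H.dim) (Fin H.dim) ℂ :=
  diagonalIn H.eigenbasis (Pi.single i 1)

lemma isDensity_eigenstate (H : Hamiltonian) (i : Fin H.dim) : IsDensity (eigenstate H i) :=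
  isDensity_diagonalIn H.eigenbasis_mem_unitaryGroup
    (fun j => (Pi.single_nonneg.2 zero_le_one : (0 : Fin H.dim → ℝ) ≤ _) j) (by simp)

lemma meanEnergy_eigenstate (H : Hamiltonian) (i : Fin H.dim) (l : Fin H.dim → ℝ) :
    meanEnergy (eigenstate H i) (diagonalIn H.eigenbasis l) = l i := by
  rw [meanEnergy_diagonalIn, eigenstate, population_diagonalIn_self H.eigenbasis_mem_unitaryGroup]
  simp [Pi.single_apply]

lemma eigenstate_mem_microstates (H : Hamiltonian) (i : Fin H.dim) :
    eigenstate H i ∈ microstates (H.levels i) H := by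
  refine ⟨isDensity_eigenstate H i, ?_⟩
  conv_lhs => rw [H.op_eq_diagonalIn]
  exact meanEnergy_eigenstate H i H.levels

end Microstates

section Qubit

/-- The two-level system with energies `0` and `g`. -/
def qubit (g : ℝ) : Hamiltonian where
  dim := 2
  dim_pos := by norm_num
  op := Matrix.diagonal fun i => ((![0, g] i : ℝ) : ℂ)
  isHermitian := by
    rw [Matrix.isHermitian_diagonal_iff]
    intro i
    simp [isSelfAdjoint_iff]

lemma Hamiltonian.range_levels {H : Hamiltonian} {d : Fin H.dim → ℝ}
    (h : H.op = Matrix.diagonal fun i => (d i : ℂ)) : Set.range H.levels = Set.range d := by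
  have h_spectrum : spectrum ℂ H.op = Complex.ofReal '' Set.range H.levels :=
    H.isHermitian.spectrum_eq_image_range
  rw [h, spectrum_diagonal, show (fun i => (d i : ℂ)) = Complex.ofReal ∘ d from rfl,
    Set.range_comp] at h_spectrum
  exact (Complex.ofReal_injective.image_injective h_spectrum).symm

lemma range_levels_qubit (g : ℝ) : Set.range (qubit g).levels = {0, g} := by
  rw [Hamiltonian.range_levels (H := qubit g) (d := ![0, g]) rfl]
  exact Matrix.range_cons_cons_empty 0 g ![]

lemma exists_levels_qubit (g : ℝ) :
    ∃ a b, (qubit g).levels a = 0 ∧ (qubit g).levels b = g := by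
  obtain ⟨a, ha⟩ : (0 : ℝ) ∈ Set.range (qubit g).levels := by simp [range_levels_qubit]
  obtain ⟨b, hb⟩ : g ∈ Set.range (qubit g).levels := by simp [range_levels_qubit]
  exact ⟨a, b, ha, hb⟩

lemma groundEnergy_qubit {g : ℝ} (hg : 0 ≤ g) : groundEnergy (qubit g) = 0 := by
  rw [groundEnergy, ← sInf_range]
  exact (congrArg sInf (range_levels_qubit g)).trans (by simp [hg])

lemma topEnergy_qubit {g : ℝ} (hg : 0 ≤ g) : topEnergy (qubit g) = g := by
  rw [topEnergy, ← sSup_range]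
  exact (congrArg sSup (range_levels_qubit g)).trans (by simp [hg])

end Qubit

section ThermalAssignments

variable {f : Hamiltonian → ℝ} {S : Hamiltonian} {e : ℝ} {ρf : Matrix (Fin S.dim) (Fin S.dim) ℂ}

lemma MacroReachable.meanEnergy_le_of_groundEnergy (h : MacroReachable f e S ρf)
    (hf : ∀ K, (microstates (f K) K).Nonempty) (he : (microstates e S).Nonempty)
    (hground : ∀ K, f K = groundEnergy K) : meanEnergy ρf S.op ≤ e := by
  refine le_of_forall_pos_le_add fun δ hδ => ?_
  obtain ⟨N, E, U, hU, hE⟩ := h.exists_unitary_meanEnergy S.op (half_pos hδ)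
  obtain ⟨ρ, hρ⟩ := he
  choose σ hσ using fun i => hf (E i)
  have hσ_density (i) := (hσ i).1
  obtain ⟨h_system, h_total⟩ := hE ρ hρ σ hσ
  rw [meanEnergy_jointEvolution_sub U hρ.1 (.tensor hσ_density), hρ.2] at h_total
  have h_absorbed : 0 ≤ absorbedEnergy E U ρ (tensor σ) := by
    rw [absorbedEnergy, sub_nonneg, meanEnergy_tensor E hσ_density,
      one_kronecker_envHamiltonian_eq_diagonalIn]
    simp only [(hσ _).2, hground]
    exact (IsDensity.jointEvolution hU hρ.1 (.tensor hσ_density)).le_meanEnergy_diagonalIn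
      (eigenbasis_kronecker_envBasis_mem_unitaryGroup S E)
      fun x => sum_groundEnergy_le_envEnergy E x.2
  linarith [abs_le.1 h_system, abs_le.1 h_total]

lemma MacroReachable.le_meanEnergy_of_topEnergy (h : MacroReachable f e S ρf)
    (hf : ∀ K, (microstates (f K) K).Nonempty) (he : (microstates e S).Nonempty)
    (htop : ∀ K, f K = topEnergy K) : e ≤ meanEnergy ρf S.op := by
  refine le_of_forall_pos_le_add fun δ hδ => ?_
  obtain ⟨N, E, U, hU, hE⟩ := h.exists_unitary_meanEnergy S.op (half_pos hδ)
  obtain ⟨ρ, hρ⟩ := he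
  choose σ hσ using fun i => hf (E i)
  have hσ_density (i) := (hσ i).1
  obtain ⟨h_system, h_total⟩ := hE ρ hρ σ hσ
  rw [meanEnergy_jointEvolution_sub U hρ.1 (.tensor hσ_density), hρ.2] at h_total
  have h_absorbed : absorbedEnergy E U ρ (tensor σ) ≤ 0 := by
    rw [absorbedEnergy, sub_nonpos, meanEnergy_tensor E hσ_density,
      one_kronecker_envHamiltonian_eq_diagonalIn]
    simp only [(hσ _).2, htop]
    exact (IsDensity.jointEvolution hU hρ.1 (.tensor hσ_density)).meanEnergy_diagonalIn_le
      (eigenbasis_kronecker_envBasis_mem_unitaryGroup S E)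
      fun x => envEnergy_le_sum_topEnergy E x.2
  linarith [abs_le.1 h_system, abs_le.1 h_total]

lemma one_sub_sum_gibbsWeight_mul_exp_le_jointEvolution {N : ℕ} {E : Fin N → Hamiltonian}
    {U : Matrix (Fin S.dim × EnvIdx E) (Fin S.dim × EnvIdx E) ℂ}
    (hU : U ∈ Matrix.unitaryGroup (Fin S.dim × EnvIdx E) ℂ) (β : ℝ) (g : Fin S.dim → ℝ) :
    letI ρ := gibbsState β S
    letI σ := tensor fun i => gibbsState β (E i)
    1 - ∑ i, gibbsWeight S.levels β i * Real.exp (-g i) ≤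
      β * (meanEnergy (jointEvolution U ρ σ) (totalHamiltonian S E) -
          meanEnergy (ρ ⊗ₖ σ) (totalHamiltonian S E)) +
        meanEnergy (traceEnv (jointEvolution U ρ σ)) (diagonalIn S.eigenbasis g) := by
  have hV := eigenbasis_kronecker_envBasis_mem_unitaryGroup S E
  obtain ⟨D, hD, h_population⟩ := exists_doublyStochastic_population hU hV
  have h_exp : ∑ x : Fin S.dim × EnvIdx E,
      gibbsWeight (fun x => S.levels x.1 + envEnergy E x.2) β x * Real.exp (-g x.1) =
        ∑ i, gibbsWeight S.levels β i * Real.exp (-g i) := by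
    simp only [gibbsWeight_add, Fintype.sum_prod_type, mul_right_comm, ← Finset.mul_sum,
      sum_gibbsWeight, mul_one]
  rw [jointEvolution, gibbsState_kronecker_tensor_gibbsState, totalHamiltonian_eq_diagonalIn,
    meanEnergy_diagonalIn, meanEnergy_diagonalIn, meanEnergy_diagonalIn,
    population_diagonalIn_self hV]
  simp only [population_traceEnv _ (envBasis_mem_unitaryGroup E), h_population, Finset.sum_mul]
  rw [← h_exp, ← Fintype.sum_prod_type' fun a x => _ * g a]
  exact one_sub_sum_gibbsWeight_mul_exp_le hD _ β fun x => g x.1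

lemma MacroReachable.one_sub_sum_gibbsWeight_mul_exp_le {β : ℝ}
    (h : MacroReachable f (f S) S ρf) (hβ : ∀ K, f K = thermalEnergy β K) (g : Fin S.dim → ℝ) :
    1 - ∑ i, gibbsWeight S.levels β i * Real.exp (-g i) ≤
      meanEnergy ρf (diagonalIn S.eigenbasis g) := by
  refine le_of_forall_pos_le_add fun ε hε => ?_
  set δ : ℝ := ε / (|β| + 1)
  have hδ : 0 < δ := by positivity
  obtain ⟨N, E, U, hU, hE⟩ := h.exists_unitary_meanEnergy (diagonalIn S.eigenbasis g) hδ
  obtain ⟨h_system, h_total⟩ := hE _ (gibbsState_mem_microstates S β hβ) _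
    fun i => gibbsState_mem_microstates (E i) β hβ
  have h_variational := one_sub_sum_gibbsWeight_mul_exp_le_jointEvolution hU β g
  have h_energy := (le_abs_self _).trans_eq (abs_mul β _)
    |>.trans (mul_le_mul_of_nonneg_left h_total (abs_nonneg β))
  have hε_eq : |β| * δ + δ = ε := by
    simp only [δ]
    field_simp
  linarith [abs_le.1 h_system]

lemma exists_gibbsWeight_le_half {ι : Type*} [Fintype ι] [Nonempty ι] {l : ι → ℝ}
    (hl : ∃ i j, l i ≠ l j) (β : ℝ) :
    ∃ i, gibbsWeight l β i ≤ 1 / 2 := by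
  obtain ⟨i, j, hij⟩ := hl
  have h_pair : gibbsWeight l β i + gibbsWeight l β j ≤ 1 := by
    classical
    rw [← sum_gibbsWeight l β, ← Finset.sum_pair (ne_of_apply_ne l hij)]
    exact Finset.sum_le_sum_of_subset_of_nonneg (Finset.subset_univ _)
      fun i _ _ => (gibbsWeight_pos l β i).le
  by_contra! h_large
  linarith [h_large i, h_large j]

lemma exists_not_macroReachable_of_thermal_coe {β : ℝ} (hβ : ∀ K, f K = thermalEnergy β K)
    (hS : ∃ i j, S.levels i ≠ S.levels j) :
    ∃ i, ¬ MacroReachable f (f S) S (eigenstate S i) := by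
  obtain ⟨i, hi⟩ := exists_gibbsWeight_le_half hS β
  refine ⟨i, fun h => ?_⟩
  have h_law := h.one_sub_sum_gibbsWeight_mul_exp_le hβ (-Pi.single i 1)
  have h_exp (j : Fin S.dim) : Real.exp (-(-Pi.single i 1 : Fin S.dim → ℝ) j) =
      1 + (Pi.single i (Real.exp 1 - 1) : Fin S.dim → ℝ) j := by
    rcases eq_or_ne j i with rfl | hji
    · simp
    · simp [hji]
  have h_sum : ∑ j, gibbsWeight S.levels β j * Real.exp (-(-Pi.single i 1 : Fin S.dim → ℝ) j) =
      1 + gibbsWeight S.levels β i * (Real.exp 1 - 1) := by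
    simp only [h_exp, mul_add, mul_one, Finset.sum_add_distrib, sum_gibbsWeight]
    simp [Pi.single_apply]
  rw [h_sum, meanEnergy_eigenstate, Pi.neg_apply, Pi.single_eq_same] at h_law
  nlinarith [Real.exp_one_lt_d9, Real.exp_one_gt_d9]

theorem not_everyTransitionPossible_of_thermal (hf : ∀ K, (microstates (f K) K).Nonempty)
    {β : EReal} (hβ : ∀ K, f K = thermalEnergy β K) : ¬ EveryTransitionPossible f := by
  intro h_all
  obtain ⟨a, b, ha, hb⟩ := exists_levels_qubit 1
  have h_reach (e : ℝ) (i) : MacroReachable f e (qubit 1) (eigenstate (qubit 1) i) :=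
    h_all e _ _ (isDensity_eigenstate _ i)
  have h_nonempty (i) := Set.nonempty_of_mem (eigenstate_mem_microstates (qubit 1) i)
  have h_energy (i) := (eigenstate_mem_microstates (qubit 1) i).2
  induction β with
  | top =>
    have h_le := (h_reach _ b).meanEnergy_le_of_groundEnergy hf (h_nonempty a)
      fun K => (hβ K).trans (thermalEnergy_top K)
    linarith [h_energy b]
  | bot =>
    have h_le := (h_reach _ a).le_meanEnergy_of_topEnergy hf (h_nonempty b)
      fun K => (hβ K).trans (thermalEnergy_bot K)
    linarith [h_energy a]
  | coe β =>
    obtain ⟨i, hi⟩ := exists_not_macroReachable_of_thermal_coe hβ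
      ⟨a, b, by rw [ha, hb]; exact zero_ne_one⟩
    exact hi (h_reach _ i)

lemma meanEnergy_tensor_gibbsState_le_conj {N : ℕ} (E : Fin N → Hamiltonian)
    {U : Matrix (EnvIdx E) (EnvIdx E) ℂ} (hU : U ∈ Matrix.unitaryGroup (EnvIdx E) ℂ) {β : ℝ}
    (hβ : 0 ≤ β) :
    meanEnergy (tensor fun i => gibbsState β (E i)) (envHamiltonian E) ≤
      meanEnergy (U * (tensor fun i => gibbsState β (E i)) * Uᴴ) (envHamiltonian E) := by
  have hV := envBasis_mem_unitaryGroup E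
  obtain ⟨D, hD, h_population⟩ := exists_doublyStochastic_population hU hV
  rw [tensor_gibbsState, envHamiltonian_eq_diagonalIn, meanEnergy_diagonalIn,
    meanEnergy_diagonalIn, population_diagonalIn_self hV, h_population]
  exact sum_mul_le_sum_mulVec_mul hD (antivary_gibbsWeight _ hβ)

theorem not_workExtractable_of_thermal (hf : ∀ K, (microstates (f K) K).Nonempty) {β : EReal}
    (hβ : ∀ K, f K = thermalEnergy β K) (hβ_nonneg : 0 ≤ β) {W : ℝ} (hW : 0 < W) :
    ¬ WorkExtractable f W := by
  rintro ⟨N, E, U, hU, h_work⟩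
  induction β with
  | top =>
    choose σ hσ using fun i => hf (E i)
    have hσ_density (i) := (hσ i).1
    have h_ground : meanEnergy (tensor σ) (envHamiltonian E) = ∑ i, groundEnergy (E i) := by
      rw [meanEnergy_tensor E hσ_density]
      simp only [(hσ _).2, hβ, thermalEnergy_top]
    have h_le : ∑ i, groundEnergy (E i) ≤ meanEnergy (U * tensor σ * Uᴴ) (envHamiltonian E) := by
      rw [envHamiltonian_eq_diagonalIn]
      exact ((IsDensity.tensor hσ_density).conj hU).le_meanEnergy_diagonalIn
        (envBasis_mem_unitaryGroup E) (sum_groundEnergy_le_envEnergy E)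
    linarith [h_work σ hσ]
  | bot => simp at hβ_nonneg
  | coe β =>
    have h_le := meanEnergy_tensor_gibbsState_le_conj E hU (EReal.coe_nonneg.1 hβ_nonneg)
    linarith [h_work _ fun i => gibbsState_mem_microstates (E i) β hβ]

end ThermalAssignments

open Filter Topology

section Entropy

variable {ι : Type*} [Fintype ι]

/-- The bound `log Z(β) + βe` on the entropy of a distribution of mean energy `e` on the energy
levels `l`. It holds for every `β`, and it is the entropy of the Gibbs distribution at inverse
temperature `β` if `e` is the energy of the latter. -/
def entropyBound (l : ι → ℝ) (e β : ℝ) : ℝ := Real.log (partitionFunction l β) + β * e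

lemma entropyBound_pi {α : Type*} [Fintype α] [DecidableEq α] {I : α → Type*} [∀ a, Fintype (I a)]
    [∀ a, Nonempty (I a)] (l : ∀ a, I a → ℝ) (e : α → ℝ) (β : ℝ) :
    entropyBound (fun x : ∀ a, I a => ∑ a, l a (x a)) (∑ a, e a) β =
      ∑ a, entropyBound (l a) (e a) β := by
  simp only [entropyBound]
  rw [partitionFunction_pi, Real.log_prod fun a _ => (partitionFunction_pos _ _).ne',
    Finset.sum_add_distrib, Finset.mul_sum]

variable [Nonempty ι]

lemma gibbsWeight_eq_exp (l : ι → ℝ) (e β : ℝ) (i : ι) :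
    gibbsWeight l β i = Real.exp (-entropyBound l e β - β * (l i - e)) := by
  rw [gibbsWeight, entropyBound, ← Real.exp_log (partitionFunction_pos l β), ← Real.exp_sub,
    Real.log_exp]
  ring_nf

lemma le_gibbsEnergy {l : ι → ℝ} {c : ℝ} (hc : ∀ i, c ≤ l i) (β : ℝ) : c ≤ gibbsEnergy l β := by
  calc c = ∑ i, gibbsWeight l β i * c := by rw [← Finset.sum_mul, sum_gibbsWeight, one_mul]
    _ ≤ gibbsEnergy l β := Finset.sum_le_sum fun i _ =>
        mul_le_mul_of_nonneg_left (hc i) (gibbsWeight_pos l β i).le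

lemma gibbsEnergy_le {l : ι → ℝ} {c : ℝ} (hc : ∀ i, l i ≤ c) (β : ℝ) : gibbsEnergy l β ≤ c := by
  calc gibbsEnergy l β ≤ ∑ i, gibbsWeight l β i * c := Finset.sum_le_sum fun i _ =>
        mul_le_mul_of_nonneg_left (hc i) (gibbsWeight_pos l β i).le
    _ = c := by rw [← Finset.sum_mul, sum_gibbsWeight, one_mul]

lemma exists_gibbsWeight_ne {l : ι → ℝ} (hl : ∃ i j, l i ≠ l j) {β γ : ℝ} (h : β ≠ γ) :
    ∃ i, gibbsWeight l β i ≠ gibbsWeight l γ i := by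
  obtain ⟨i, j, hij⟩ := hl
  by_contra! h_eq
  have h_exp : Real.exp (β * (l i - l j)) = Real.exp (γ * (l i - l j)) := by
    refine mul_left_cancel₀ (gibbsWeight_pos l β i).ne' ?_
    rw [gibbsWeight_mul_exp, h_eq i, gibbsWeight_mul_exp, h_eq j]
  exact h (mul_right_cancel₀ (sub_ne_zero.2 hij) (Real.exp_injective h_exp))

lemma log_gibbsWeight (l : ι → ℝ) (β : ℝ) (i : ι) :
    Real.log (gibbsWeight l β i) = -Real.log (partitionFunction l β) - β * l i := by
  rw [gibbsWeight_eq_exp l 0, Real.log_exp, entropyBound]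
  ring

lemma sub_mul_log_sub_log_pos {x y : ℝ} (hx : 0 < x) (hy : 0 < y) (h : x ≠ y) :
    0 < (x - y) * (Real.log x - Real.log y) := by
  rcases h.lt_or_gt with hxy | hyx
  · exact mul_pos_of_neg_of_neg (sub_neg.2 hxy) (sub_neg.2 (Real.log_lt_log hx hxy))
  · exact mul_pos (sub_pos.2 hyx) (sub_pos.2 (Real.log_lt_log hy hyx))

/-- `(γ - β) (u(β) - u(γ))` is the symmetrised relative entropy of the two Gibbs distributions. -/
lemma gibbsEnergy_strictAnti {l : ι → ℝ} (hl : ∃ i j, l i ≠ l j) : StrictAnti (gibbsEnergy l) := by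
  intro β γ h_lt
  set p := gibbsWeight l β with hp
  set q := gibbsWeight l γ with hq
  have h_divergence : ∑ i, (p i - q i) * (Real.log (p i) - Real.log (q i)) =
      (γ - β) * (gibbsEnergy l β - gibbsEnergy l γ) := by
    set c := Real.log (partitionFunction l γ) - Real.log (partitionFunction l β)
    calc ∑ i, (p i - q i) * (Real.log (p i) - Real.log (q i))
        = ∑ i, (c * p i - c * q i + (γ - β) * (p i * l i - q i * l i)) :=
          Finset.sum_congr rfl fun i _ => by rw [hp, hq, log_gibbsWeight, log_gibbsWeight]; ring
      _ = (γ - β) * (gibbsEnergy l β - gibbsEnergy l γ) := by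
          rw [Finset.sum_add_distrib, Finset.sum_sub_distrib, ← Finset.mul_sum, ← Finset.mul_sum,
            ← Finset.mul_sum, Finset.sum_sub_distrib, hp, hq, sum_gibbsWeight, sum_gibbsWeight,
            sub_self, zero_add, gibbsEnergy, gibbsEnergy]
  have h_divergence_pos : 0 < ∑ i, (p i - q i) * (Real.log (p i) - Real.log (q i)) := by
    have h_term_pos (i : ι) (hi : p i ≠ q i) :=
      sub_mul_log_sub_log_pos (gibbsWeight_pos l β i) (gibbsWeight_pos l γ i) hi
    obtain ⟨i, hi⟩ := exists_gibbsWeight_ne hl h_lt.ne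
    refine Finset.sum_pos' (fun j _ => ?_) ⟨i, Finset.mem_univ i, h_term_pos i hi⟩
    by_cases hj : p j = q j
    · rw [hj, sub_self, zero_mul]
    · exact (h_term_pos j hj).le
  rw [h_divergence] at h_divergence_pos
  exact sub_pos.1 (pos_of_mul_pos_right h_divergence_pos (sub_pos.2 h_lt).le)

lemma hasDerivAt_log_partitionFunction (l : ι → ℝ) (β : ℝ) :
    HasDerivAt (fun β => Real.log (partitionFunction l β)) (-gibbsEnergy l β) β := by
  have h_deriv : HasDerivAt (partitionFunction l) (∑ i, Real.exp (-β * l i) * (-1 * l i)) β :=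
    HasDerivAt.fun_sum fun i _ => ((hasDerivAt_neg β).mul_const (l i)).exp
  convert h_deriv.log (partitionFunction_pos l β).ne' using 1
  rw [gibbsEnergy, ← Finset.sum_neg_distrib, Finset.sum_div]
  refine Finset.sum_congr rfl fun i _ => ?_
  rw [gibbsWeight]
  ring

lemma hasDerivAt_entropyBound (l : ι → ℝ) (e β : ℝ) :
    HasDerivAt (entropyBound l e) (e - gibbsEnergy l β) β :=
  ((hasDerivAt_log_partitionFunction l β).add ((hasDerivAt_id β).mul_const e)).congr_deriv (by ring)

lemma continuous_entropyBound (l : ι → ℝ) (e : ℝ) : Continuous (entropyBound l e) :=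
  continuous_iff_continuousAt.2 fun β => (hasDerivAt_entropyBound l e β).continuousAt

@[fun_prop]
lemma continuous_gibbsEnergy (l : ι → ℝ) : Continuous (gibbsEnergy l) := by
  have h_partition : Continuous (partitionFunction l) := by unfold partitionFunction; fun_prop
  have h_weight (i : ι) : Continuous fun β => gibbsWeight l β i :=
    Continuous.div (by fun_prop) h_partition fun β => (partitionFunction_pos l β).ne'
  unfold gibbsEnergy
  fun_prop

lemma mul_sub_le_entropyBound (l : ι → ℝ) (e β : ℝ) (i : ι) :
    β * (e - l i) ≤ entropyBound l e β := by
  have h_le : -β * l i ≤ Real.log (partitionFunction l β) := by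
    rw [Real.le_log_iff_exp_le (partitionFunction_pos l β)]
    exact Finset.single_le_sum (f := fun i => Real.exp (-β * l i))
      (fun i _ => (Real.exp_pos _).le) (Finset.mem_univ i)
  rw [entropyBound]
  linarith

lemma exists_gibbsEnergy_eq {l : ι → ℝ} {e : ℝ} (h_low : ∃ i, l i < e) (h_high : ∃ i, e < l i) :
    ∃ β, gibbsEnergy l β = e := by
  have h_coercive : Tendsto (entropyBound l e) (cocompact ℝ) atTop := by
    rw [cocompact_eq_atBot_atTop, tendsto_sup]
    constructor
    · obtain ⟨i, hi⟩ := h_high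
      exact tendsto_atTop_mono (fun β => mul_sub_le_entropyBound l e β i)
        (tendsto_id.atBot_mul_const_of_neg (sub_neg.2 hi))
    · obtain ⟨i, hi⟩ := h_low
      exact tendsto_atTop_mono (fun β => mul_sub_le_entropyBound l e β i)
        (tendsto_id.atTop_mul_const (sub_pos.2 hi))
  obtain ⟨β, hβ⟩ := (continuous_entropyBound l e).exists_forall_le h_coercive
  have h_deriv := IsLocalMin.hasDerivAt_eq_zero (Eventually.of_forall hβ)
    (hasDerivAt_entropyBound l e β)
  exact ⟨β, (sub_eq_zero.1 h_deriv).symm⟩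

lemma exists_entropyBound_lt {l : ι → ℝ} {e β : ℝ} (h : gibbsEnergy l β ≠ e) :
    ∃ b, entropyBound l e b < entropyBound l e β := by
  by_contra! h_min
  have h_deriv := IsLocalMin.hasDerivAt_eq_zero (Eventually.of_forall h_min)
    (hasDerivAt_entropyBound l e β)
  exact h (sub_eq_zero.1 h_deriv).symm

end Entropy

section Temperature

variable {H : Hamiltonian} {e : ℝ}

lemma groundEnergy_le_gibbsEnergy (H : Hamiltonian) (β : ℝ) :
    groundEnergy H ≤ gibbsEnergy H.levels β :=
  le_gibbsEnergy H.groundEnergy_le_levels β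

lemma gibbsEnergy_le_topEnergy (H : Hamiltonian) (β : ℝ) :
    gibbsEnergy H.levels β ≤ topEnergy H :=
  gibbsEnergy_le H.levels_le_topEnergy β

lemma exists_thermalEnergy_eq (h_low : groundEnergy H ≤ e) (h_high : e ≤ topEnergy H) :
    ∃ β : EReal, thermalEnergy β H = e := by
  rcases h_low.eq_or_lt with rfl | h_low
  · exact ⟨⊤, thermalEnergy_top H⟩
  rcases h_high.eq_or_lt with rfl | h_high
  · exact ⟨⊥, thermalEnergy_bot H⟩
  obtain ⟨i, hi⟩ := H.exists_levels_eq_groundEnergy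
  obtain ⟨j, hj⟩ := H.exists_levels_eq_topEnergy
  obtain ⟨β, hβ⟩ := exists_gibbsEnergy_eq ⟨i, hi.trans_lt h_low⟩ ⟨j, h_high.trans_eq hj.symm⟩
  exact ⟨β, by rw [thermalEnergy_coe_eq_gibbsEnergy, hβ]⟩

lemma thermalEnergy_strictAnti (hH : ∃ i j, H.levels i ≠ H.levels j) :
    StrictAnti fun β : EReal => thermalEnergy β H := by
  have h_anti := gibbsEnergy_strictAnti hH
  have h_ground (β : ℝ) : groundEnergy H < gibbsEnergy H.levels β :=
    (groundEnergy_le_gibbsEnergy H (β + 1)).trans_lt (h_anti (lt_add_one β))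
  have h_top (β : ℝ) : gibbsEnergy H.levels β < topEnergy H :=
    (h_anti (sub_one_lt β)).trans_le (gibbsEnergy_le_topEnergy H (β - 1))
  intro β γ h_lt
  induction β with
  | top => exact absurd h_lt not_top_lt
  | bot =>
    simp only [thermalEnergy_bot]
    induction γ with
    | bot => exact absurd h_lt (lt_irrefl ⊥)
    | coe γ => exact (thermalEnergy_coe_eq_gibbsEnergy H γ).trans_lt (h_top γ)
    | top => exact (thermalEnergy_top H).trans_lt ((h_ground 0).trans (h_top 0))
  | coe β =>
    simp only [thermalEnergy_coe_eq_gibbsEnergy]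
    induction γ with
    | bot => exact absurd h_lt not_lt_bot
    | coe γ =>
      exact (thermalEnergy_coe_eq_gibbsEnergy H γ).trans_lt (h_anti (EReal.coe_lt_coe_iff.1 h_lt))
    | top => exact (thermalEnergy_top H).trans_lt (h_ground β)

/-- The inverse temperature of the two-level system cannot be that of every other system. -/
lemma exists_no_common_temperature {f : Hamiltonian → ℝ}
    (hf : ∀ K, (microstates (f K) K).Nonempty)
    (h_nonthermal : ¬ ∃ β : EReal, ∀ K, f K = thermalEnergy β K) :
    ∃ K : Fin 2 → Hamiltonian,
      (∃ x : ∀ i, Fin (K i).dim, ∑ i, (K i).levels (x i) < ∑ i, f (K i)) ∧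
      (∃ x : ∀ i, Fin (K i).dim, ∑ i, f (K i) < ∑ i, (K i).levels (x i)) ∧
      ∀ β, ∃ i, gibbsEnergy (K i).levels β ≠ f (K i) := by
  obtain ⟨a, b, ha, hb⟩ := exists_levels_qubit 1
  have h_inj := (thermalEnergy_strictAnti (H := qubit 1)
    ⟨a, b, by rw [ha, hb]; exact zero_ne_one⟩).injective
  obtain ⟨β, hβ⟩ := exists_thermalEnergy_eq (groundEnergy_le_of_nonempty (hf (qubit 1)))
    (le_topEnergy_of_nonempty (hf (qubit 1)))
  obtain ⟨H, hH⟩ : ∃ H, f H ≠ thermalEnergy β H := by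
    by_contra! h
    exact h_nonthermal ⟨β, h⟩
  have h_not_common (γ : EReal) (hγ : thermalEnergy γ (qubit 1) = f (qubit 1)) :
      thermalEnergy γ H ≠ f H := by
    rw [h_inj (hγ.trans hβ.symm)]
    exact hH.symm
  set K : Fin 2 → Hamiltonian := ![qubit 1, H]
  have h_ne (γ : EReal) : ∃ i, thermalEnergy γ (K i) ≠ f (K i) := by
    by_contra! h
    exact h_not_common γ (h 0) (h 1)
  choose x_low hx_low using fun i => (K i).exists_levels_eq_groundEnergy
  choose x_top hx_top using fun i => (K i).exists_levels_eq_topEnergy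
  refine ⟨K, ⟨x_low, ?_⟩, ⟨x_top, ?_⟩, fun γ => ?_⟩
  · obtain ⟨i, hi⟩ := h_ne ⊤
    have h_le (j : Fin 2) := groundEnergy_le_of_nonempty (hf (K j))
    rw [thermalEnergy_top] at hi
    simp only [hx_low]
    exact Finset.sum_lt_sum (fun j _ => h_le j) ⟨i, Finset.mem_univ i, (h_le i).lt_of_ne hi⟩
  · obtain ⟨i, hi⟩ := h_ne ⊥
    have h_le (j : Fin 2) := le_topEnergy_of_nonempty (hf (K j))
    rw [thermalEnergy_bot] at hi
    simp only [hx_top]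
    exact Finset.sum_lt_sum (fun j _ => h_le j) ⟨i, Finset.mem_univ i, (h_le i).lt_of_ne' hi⟩
  · simpa only [thermalEnergy_coe_eq_gibbsEnergy] using h_ne γ

end Temperature

section Resource

variable {ι : Type*} [Fintype ι] [DecidableEq ι] {A : ι → Type*} [∀ i, Fintype (A i)]
  [∀ i, Nonempty (A i)]

lemma gibbsEnergy_pi (l : ∀ i, A i → ℝ) (β : ℝ) :
    gibbsEnergy (fun x : ∀ i, A i => ∑ i, l i (x i)) β = ∑ i, gibbsEnergy (l i) β := by
  have h_deriv : HasDerivAt (fun β => ∑ i, entropyBound (l i) 0 β)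
      (∑ i, (0 - gibbsEnergy (l i) β)) β :=
    HasDerivAt.fun_sum fun i _ => hasDerivAt_entropyBound (l i) 0 β
  have h_deriv_pi := hasDerivAt_entropyBound (fun x : ∀ i, A i => ∑ i, l i (x i)) (∑ _i : ι, 0) β
  rw [funext fun β => entropyBound_pi l (fun _ => 0) β] at h_deriv_pi
  have h_eq := h_deriv_pi.unique h_deriv
  simp only [Finset.sum_const_zero, zero_sub, Finset.sum_neg_distrib] at h_eq
  exact neg_injective h_eq

omit [DecidableEq ι] in
/-- At the common inverse temperature that accounts for the total energy, the entropy is larger than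
what the given energies of the individual systems allow for. -/
lemma exists_entropyBound_gap {l : ∀ i, A i → ℝ} {e : ι → ℝ}
    (h_low : ∃ x : ∀ i, A i, ∑ i, l i (x i) < ∑ i, e i)
    (h_high : ∃ x : ∀ i, A i, ∑ i, e i < ∑ i, l i (x i))
    (h_ne : ∀ β, ∃ i, gibbsEnergy (l i) β ≠ e i) :
    ∃ (β : ℝ) (b : ι → ℝ), ∑ i, gibbsEnergy (l i) β = ∑ i, e i ∧
      ∑ i, entropyBound (l i) (e i) (b i) <
        ∑ i, entropyBound (l i) (gibbsEnergy (l i) β) β := by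
  classical
  obtain ⟨β, hβ⟩ := exists_gibbsEnergy_eq h_low h_high
  rw [gibbsEnergy_pi] at hβ
  obtain ⟨i, hi⟩ := h_ne β
  obtain ⟨c, hc⟩ := exists_entropyBound_lt hi
  refine ⟨β, Function.update (fun _ => β) i c, hβ, ?_⟩
  calc ∑ j, entropyBound (l j) (e j) (Function.update (fun _ => β) i c j)
      < ∑ j, entropyBound (l j) (e j) β := by
        refine Finset.sum_lt_sum (fun j _ => ?_) ⟨i, Finset.mem_univ i, by simpa using hc⟩
        rcases eq_or_ne j i with rfl | h
        · simpa using hc.le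
        · simp [h]
    _ = ∑ j, entropyBound (l j) (gibbsEnergy (l j) β) β := by
        simp only [entropyBound, Finset.sum_add_distrib, ← Finset.mul_sum, hβ]

lemma continuous_entropyBound_gibbsEnergy {X : Type*} [Fintype X] [Nonempty X] (l : X → ℝ) :
    Continuous fun β => entropyBound l (gibbsEnergy l β) β := by
  have h_eq : (fun β => entropyBound l (gibbsEnergy l β) β) =
      fun β => entropyBound l 0 β + β * gibbsEnergy l β := by
    funext β
    simp only [entropyBound, mul_zero, add_zero]
  rw [h_eq]
  exact (continuous_entropyBound l 0).add (by fun_prop)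

lemma exists_lt_add_and_add_lt_of_strictAnti {g : ℝ → ℝ} (h_anti : StrictAnti g) {x₀ : ℝ}
    (h_cont : ContinuousAt g x₀) {p : ℝ → Prop} (hp : ∀ᶠ x in 𝓝 x₀, p x) {e₀ η : ℝ} (hη : 0 < η)
    (he₀ : e₀ ∈ Set.Icc 0 η) : ∃ x, p x ∧ g x < e₀ + g x₀ ∧ e₀ + g x₀ < g x + η := by
  rcases he₀.1.eq_or_lt with rfl | he₀_pos
  · have h_near := hp.and (h_cont.eventually_const_lt (sub_lt_self _ hη))
    obtain ⟨x, ⟨hpx, h_le⟩, hx⟩ := ((h_near.filter_mono nhdsWithin_le_nhds).and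
      (eventually_mem_nhdsWithin (s := Set.Ioi x₀))).exists
    exact ⟨x, hpx, by linarith [h_anti (Set.mem_Ioi.1 hx)], by linarith⟩
  · have h_near := hp.and (h_cont.eventually_lt_const (lt_add_of_pos_left _ he₀_pos))
    obtain ⟨x, ⟨hpx, h_le⟩, hx⟩ := ((h_near.filter_mono nhdsWithin_le_nhds).and
      (eventually_mem_nhdsWithin (s := Set.Iio x₀))).exists
    exact ⟨x, hpx, h_le, by linarith [h_anti (Set.mem_Iio.1 hx), he₀.2]⟩

omit [DecidableEq ι] in
/-- Many copies of the systems `l` compensate for any entropy `s`. A slight change of their final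
temperature makes up for the missing or excess energy `e₀`. -/
lemma exists_entropyBound_gap_of_mem_Icc {l : ∀ i, A i → ℝ} {e : ι → ℝ}
    (h_low : ∃ x : ∀ i, A i, ∑ i, l i (x i) < ∑ i, e i)
    (h_high : ∃ x : ∀ i, A i, ∑ i, e i < ∑ i, l i (x i))
    (h_ne : ∀ β, ∃ i, gibbsEnergy (l i) β ≠ e i) (s : ℝ) {e₀ η : ℝ} (hη : 0 < η)
    (he₀ : e₀ ∈ Set.Icc 0 η) :
    ∃ (w : ℕ) (β : ℝ) (b : ι → ℝ),
      s + w * ∑ i, entropyBound (l i) (e i) (b i) <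
        w * ∑ i, entropyBound (l i) (gibbsEnergy (l i) β) β ∧
      w * ∑ i, gibbsEnergy (l i) β < e₀ + w * ∑ i, e i ∧
      e₀ + w * ∑ i, e i < w * ∑ i, gibbsEnergy (l i) β + η := by
  classical
  obtain ⟨β₀, b, hβ₀, h_gap⟩ := exists_entropyBound_gap h_low h_high h_ne
  obtain ⟨w, hw⟩ := exists_lt_nsmul (sub_pos.2 h_gap) (max 0 s)
  rw [nsmul_eq_mul] at hw
  have hw_pos : (0 : ℝ) < w :=
    pos_of_mul_pos_left ((le_max_left 0 s).trans_lt hw) (sub_pos.2 h_gap).le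
  have h_anti : StrictAnti fun β => w * ∑ i, gibbsEnergy (l i) β := by
    obtain ⟨x, hx⟩ := h_low
    obtain ⟨y, hy⟩ := h_high
    simp only [← gibbsEnergy_pi]
    exact (gibbsEnergy_strictAnti ⟨x, y, (hx.trans hy).ne⟩).const_mul hw_pos
  have h_entropy : ∀ᶠ β in 𝓝 β₀, s + w * ∑ i, entropyBound (l i) (e i) (b i) <
      w * ∑ i, entropyBound (l i) (gibbsEnergy (l i) β) β := by
    have h_cont := (continuous_finsetSum Finset.univ fun i _ =>
      continuous_entropyBound_gibbsEnergy (l i)).const_mul (w : ℝ)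
    exact (h_cont.tendsto β₀).eventually_const_lt (by linarith [le_max_right 0 s])
  obtain ⟨β, h_gap_near, h_lt, h_gt⟩ := exists_lt_add_and_add_lt_of_strictAnti h_anti
    (Continuous.continuousAt (by fun_prop)) h_entropy hη he₀
  simp only [hβ₀] at h_lt h_gt
  exact ⟨w, β, b, h_gap_near, h_lt, h_gt⟩

end Resource

section Cell

/-- A finite family of systems with energy levels `L` and mean energies `m` that is worth more
entropy in thermal equilibrium: at inverse temperature `β`, the systems `some i` alone have a larger
entropy than the bounds on the entropy of the whole family given by the inverse temperatures `b`.
The system `none` is a battery, with levels `0` and `η`, and can absorb the energy difference. -/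
structure IsResource {ι : Type*} [Fintype ι] {A : Option ι → Type*} [∀ c, Fintype (A c)]
    (L : ∀ c, A c → ℝ) (m b : Option ι → ℝ) (β η : ℝ) : Prop where
  entropyBound_lt : ∑ c, entropyBound (L c) (m c) (b c) <
    ∑ i, entropyBound (L (some i)) (gibbsEnergy (L (some i)) β) β
  energy_lt : ∑ i, gibbsEnergy (L (some i)) β < ∑ c, m c
  lt_energy : ∑ c, m c < ∑ i, gibbsEnergy (L (some i)) β + η
  exists_low : ∃ a, L none a = 0
  exists_high : ∃ a, L none a = η

lemma exists_isResource {f : Hamiltonian → ℝ} (hf : ∀ K, (microstates (f K) K).Nonempty)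
    (h_nonthermal : ¬ ∃ β : EReal, ∀ K, f K = thermalEnergy β K) {η : ℝ} (hη : 0 < η) :
    ∃ (w : ℕ) (cell : Option (Fin w × Fin 2) → Hamiltonian)
      (b : Option (Fin w × Fin 2) → ℝ) (β : ℝ),
      IsResource (fun c => (cell c).levels) (fun c => f (cell c)) b β η := by
  obtain ⟨K, h_low, h_high, h_ne⟩ := exists_no_common_temperature hf h_nonthermal
  have h_battery : f (qubit η) ∈ Set.Icc 0 η :=
    ⟨(groundEnergy_qubit hη.le).symm.trans_le (groundEnergy_le_of_nonempty (hf _)),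
      (le_topEnergy_of_nonempty (hf _)).trans_eq (topEnergy_qubit hη.le)⟩
  obtain ⟨w, β, b, h_gap, h_lt, h_gt⟩ := exists_entropyBound_gap_of_mem_Icc h_low h_high h_ne
    (entropyBound (qubit η).levels (f (qubit η)) 0) hη h_battery
  obtain ⟨low, high, h_zero, h_eta⟩ := exists_levels_qubit η
  have h_sum (F : Fin 2 → ℝ) : w * ∑ i, F i = ∑ x : Fin w × Fin 2, F x.2 := by
    simp only [Fintype.sum_prod_type, Finset.sum_const, Finset.card_univ, Fintype.card_fin,
      nsmul_eq_mul]
  rw [h_sum, h_sum] at h_gap h_lt h_gt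
  let cell (c : Option (Fin w × Fin 2)) : Hamiltonian := c.elim (qubit η) fun x => K x.2
  exact ⟨w, cell, fun c => c.elim 0 fun x => b x.2, β, (Fintype.sum_option _).trans_lt h_gap,
    h_lt.trans_eq (Fintype.sum_option fun c => f (cell c)).symm,
    (Fintype.sum_option _).trans_lt h_gt, ⟨low, h_zero⟩, ⟨high, h_eta⟩⟩

end Cell

section GentleMeasurement

open scoped Matrix.Norms.L2Operator MatrixOrder

variable {ι : Type*} [Fintype ι] [DecidableEq ι]

omit [DecidableEq ι] in
lemma norm_trace_mul_mul_conjTranspose_le {M : Matrix ι ι ℂ} (hM : M.PosSemidef)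
    (X Y : Matrix ι ι ℂ) :
    ‖(Y * M * Xᴴ).trace‖ ≤ √(X * M * Xᴴ).trace.re * √(Y * M * Yᴴ).trace.re := by
  let := M.toMatrixSeminormedAddCommGroup hM
  let := M.toMatrixInnerProductSpace hM
  have h_norm (Z : Matrix ι ι ℂ) : ‖Z‖ = √(Z * M * Zᴴ).trace.re :=
    norm_eq_sqrt_re_inner (𝕜 := ℂ) Z
  rw [← h_norm, ← h_norm]
  exact norm_inner_le_norm (𝕜 := ℂ) X Y

lemma re_trace_mul_mul_conjTranspose_le {M : Matrix ι ι ℂ} (hM : M.PosSemidef)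
    (B : Matrix ι ι ℂ) : (B * M * Bᴴ).trace.re ≤ ‖B‖ ^ 2 * M.trace.re := by
  obtain ⟨C, rfl⟩ := CStarAlgebra.nonneg_iff_eq_star_mul_self.1 hM.nonneg
  rw [Matrix.star_eq_conjTranspose]
  have h_le : (algebraMap ℝ (Matrix ι ι ℂ) (‖B‖ ^ 2) - star B * B).PosSemidef :=
    Matrix.le_iff.1 CStarAlgebra.star_mul_le_algebraMap_norm_sq
  have h_trace := (Complex.nonneg_iff.1 (h_le.mul_mul_conjTranspose_same C).trace_nonneg).1
  have h_cycle : (B * (Cᴴ * C) * Bᴴ).trace = (C * (Bᴴ * B) * Cᴴ).trace := by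
    rw [← mul_assoc, mul_assoc, Matrix.trace_mul_comm]
    simp only [mul_assoc]
  rw [h_cycle, Matrix.trace_mul_comm Cᴴ]
  simp only [Matrix.star_eq_conjTranspose, mul_sub, sub_mul, Matrix.trace_sub, Complex.sub_re,
    sub_nonneg, Algebra.algebraMap_eq_smul_one, Matrix.mul_smul, Matrix.smul_mul, mul_one,
    Matrix.trace_smul, Complex.real_smul, Complex.re_ofReal_mul] at h_trace
  exact h_trace

lemma norm_trace_mul_mul_le_of_posSemidef {M : Matrix ι ι ℂ} (hM : M.PosSemidef)
    (B Q : Matrix ι ι ℂ) :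
    ‖(Q * M * B).trace‖ ≤ ‖B‖ * √M.trace.re * √(Q * M * Qᴴ).trace.re := by
  have h_bound := norm_trace_mul_mul_conjTranspose_le hM Bᴴ Q
  rw [Matrix.conjTranspose_conjTranspose] at h_bound
  refine h_bound.trans (mul_le_mul_of_nonneg_right ?_ (Real.sqrt_nonneg _))
  have h_norm := re_trace_mul_mul_conjTranspose_le hM Bᴴ
  rw [Matrix.conjTranspose_conjTranspose, Matrix.l2_opNorm_conjTranspose] at h_norm
  calc √(Bᴴ * M * B).trace.re ≤ √(‖B‖ ^ 2 * M.trace.re) := Real.sqrt_le_sqrt h_norm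
    _ = ‖B‖ * √M.trace.re := by
        rw [Real.sqrt_mul (sq_nonneg _), Real.sqrt_sq (norm_nonneg _)]

lemma IsDensity.norm_trace_mul_le {ω : Matrix ι ι ℂ} (hω : IsDensity ω) (B : Matrix ι ι ℂ) :
    ‖(ω * B).trace‖ ≤ ‖B‖ := by
  simpa [hω.2] using norm_trace_mul_mul_le_of_posSemidef hω.1 B 1

/-- The projection onto the coordinates in `T`, which implements the measurement of `T`. -/
def coordProjection (T : Finset ι) : Matrix ι ι ℂ :=
  Matrix.diagonal fun i => if i ∈ T then 1 else 0

lemma isStarProjection_coordProjection (T : Finset ι) :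
    IsStarProjection (coordProjection T) := by
  refine ⟨?_, ?_⟩
  · simp [IsIdempotentElem, coordProjection]
  · rw [IsSelfAdjoint, Matrix.star_eq_conjTranspose, coordProjection,
      Matrix.diagonal_conjTranspose]
    congr 1
    ext i
    simp [apply_ite star]

lemma coordProjection_add_compl (T : Finset ι) :
    coordProjection T + coordProjection Tᶜ = 1 := by
  rw [coordProjection, coordProjection, Matrix.diagonal_add, ← Matrix.diagonal_one]
  congr 1
  ext i
  by_cases hi : i ∈ T <;> simp [hi]

lemma coordProjection_mul_mul_apply (T : Finset ι) (B : Matrix ι ι ℂ) (i j : ι) :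
    (coordProjection T * B * coordProjection T) i j = if i ∈ T ∧ j ∈ T then B i j else 0 := by
  by_cases hi : i ∈ T <;> by_cases hj : j ∈ T <;> simp [coordProjection, hi, hj]

lemma re_trace_coordProjection_conj (T : Finset ι) (ω : Matrix ι ι ℂ) :
    (coordProjection T * ω * (coordProjection T)ᴴ).trace.re = ∑ i ∈ T, (ω i i).re := by
  rw [← Matrix.star_eq_conjTranspose, (isStarProjection_coordProjection T).isSelfAdjoint]
  simp [Matrix.trace, coordProjection_mul_mul_apply]

lemma norm_trace_mul_sub_le {ω : Matrix ι ι ℂ} (hω : IsDensity ω) (T : Finset ι)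
    (B : Matrix ι ι ℂ) :
    ‖(ω * B).trace - (ω * (coordProjection T * B * coordProjection T)).trace‖ ≤
      2 * ‖B‖ * √(∑ i ∈ Tᶜ, (ω i i).re) := by
  set P := coordProjection T
  set Q := coordProjection Tᶜ
  have hP : Pᴴ = P := (isStarProjection_coordProjection T).isSelfAdjoint
  have hQ : Qᴴ = Q := (isStarProjection_coordProjection Tᶜ).isSelfAdjoint
  have h_sum : P + Q = 1 := coordProjection_add_compl T
  have h_bound (C : Matrix ι ι ℂ) (hC : ‖C‖ ≤ ‖B‖) :
      ‖(Q * ω * C).trace‖ ≤ ‖B‖ * √(∑ i ∈ Tᶜ, (ω i i).re) := by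
    have h_trace := norm_trace_mul_mul_le_of_posSemidef hω.1 C Q
    rw [re_trace_coordProjection_conj, hω.2, Complex.one_re, Real.sqrt_one, mul_one] at h_trace
    exact h_trace.trans (mul_le_mul_of_nonneg_right hC (Real.sqrt_nonneg _))
  have h_norm : ‖P * Bᴴ‖ ≤ ‖B‖ := by
    calc ‖P * Bᴴ‖ ≤ ‖P‖ * ‖Bᴴ‖ := norm_mul_le _ _
      _ ≤ 1 * ‖Bᴴ‖ := by
          gcongr
          exact (isStarProjection_coordProjection T).norm_le
      _ = ‖B‖ := by rw [one_mul, Matrix.l2_opNorm_conjTranspose]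
  have h_offDiagonal : star (Q * ω * (P * Bᴴ)).trace = (ω * (Q * B * P)).trace := by
    rw [← Matrix.trace_conjTranspose]
    simp only [Matrix.conjTranspose_mul, Matrix.conjTranspose_conjTranspose, hP, hQ, hω.1.1.eq]
    rw [mul_assoc, ← mul_assoc, Matrix.trace_mul_comm, ← mul_assoc, ← mul_assoc, ← mul_assoc]
  have h_split : (ω * B).trace - (ω * (P * B * P)).trace =
      (Q * ω * B).trace + star (Q * ω * (P * Bᴴ)).trace := by
    have h_resolve : B = P * B * P + Q * B * P + B * Q := by
      rw [← add_mul, ← add_mul, h_sum, one_mul, ← mul_add, h_sum, mul_one]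
    have h_trace : (ω * B).trace =
        (ω * (P * B * P)).trace + (ω * (Q * B * P)).trace + (ω * (B * Q)).trace := by
      rw [← Matrix.trace_add, ← Matrix.trace_add, ← mul_add, ← mul_add, ← h_resolve]
    have h_cycle : (Q * ω * B).trace = (ω * (B * Q)).trace := by
      rw [mul_assoc, Matrix.trace_mul_comm, mul_assoc]
    rw [h_offDiagonal, h_cycle, h_trace]
    ring
  rw [h_split]
  calc _ ≤ ‖(Q * ω * B).trace‖ + ‖star (Q * ω * (P * Bᴴ)).trace‖ := norm_add_le _ _
    _ ≤ _ := by
        rw [norm_star]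
        linarith [h_bound B le_rfl, h_bound _ h_norm]

lemma IsDensity.norm_sum_diag_mul_le {ω : Matrix ι ι ℂ} (hω : IsDensity ω) (T : Finset ι)
    {d : ι → ℂ} {η D : ℝ} (hη : 0 ≤ η) (hd : ∀ i ∈ T, ‖d i‖ ≤ η) (hD : ∀ i ∉ T, ‖d i‖ ≤ D) :
    ‖∑ i, ω i i * d i‖ ≤ η + D * ∑ i ∈ Tᶜ, (ω i i).re := by
  have h_nonneg (i : ι) : 0 ≤ (ω i i).re := (Complex.nonneg_iff.1 hω.1.diag_nonneg).1
  have h_norm (i : ι) : ‖ω i i‖ = (ω i i).re := (Complex.re_eq_norm.2 hω.1.diag_nonneg).symm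
  have h_inside : ∑ i ∈ T, (ω i i).re ≤ 1 := by
    rw [← Complex.one_re, ← hω.2, Matrix.trace, Complex.re_sum]
    exact Finset.sum_le_univ_sum_of_nonneg h_nonneg
  calc ‖∑ i, ω i i * d i‖ ≤ ∑ i, (ω i i).re * ‖d i‖ :=
        norm_sum_le_of_le _ fun i _ => by rw [norm_mul, h_norm]
    _ = ∑ i ∈ T, (ω i i).re * ‖d i‖ + ∑ i ∈ Tᶜ, (ω i i).re * ‖d i‖ :=
        (Finset.sum_add_sum_compl T _).symm
    _ ≤ ∑ i ∈ T, (ω i i).re * η + ∑ i ∈ Tᶜ, (ω i i).re * D := by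
        gcongr with i hi i hi
        · exact h_nonneg i
        · exact hd i hi
        · exact h_nonneg i
        · exact hD i (Finset.mem_compl.1 hi)
    _ ≤ η + D * ∑ i ∈ Tᶜ, (ω i i).re := by
        rw [← Finset.sum_mul, ← Finset.sum_mul, mul_comm D]
        gcongr
        exact mul_le_of_le_one_left hη h_inside

lemma IsDensity.norm_trace_mul_sub_sum_le {ω : Matrix ι ι ℂ} (hω : IsDensity ω) (T : Finset ι)
    {B : Matrix ι ι ℂ} {b c : ι → ℂ}
    (hB : ∀ i ∈ T, ∀ j ∈ T, B i j = if i = j then b i else 0) {η D : ℝ} (hη : 0 ≤ η)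
    (hbc : ∀ i ∈ T, ‖b i - c i‖ ≤ η) (hD : 0 ≤ D) (hc : ∀ i, ‖c i‖ ≤ D) :
    ‖(ω * B).trace - ∑ i, ω i i * c i‖ ≤ η + (2 * ‖B‖ + D) * √(∑ i ∈ Tᶜ, (ω i i).re) := by
  set s : ℝ := ∑ i ∈ Tᶜ, (ω i i).re
  have h_block : (ω * (coordProjection T * B * coordProjection T)).trace =
      ∑ i, ω i i * if i ∈ T then b i else 0 := by
    have h_diagonal : coordProjection T * B * coordProjection T =
        Matrix.diagonal fun i => if i ∈ T then b i else 0 := by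
      ext i j
      rw [coordProjection_mul_mul_apply, Matrix.diagonal_apply]
      by_cases hi : i ∈ T <;> by_cases hj : j ∈ T <;> by_cases hij : i = j <;> simp_all
    simp [h_diagonal, Matrix.trace]
  have h_sum := hω.norm_sum_diag_mul_le T (d := fun i => (if i ∈ T then b i else 0) - c i) hη
    (fun i hi => by simpa [hi] using hbc i hi) (fun i hi => by simpa [hi] using hc i)
  have h_le_sqrt : s ≤ √s := by
    have hs : s ≤ 1 := by
      rw [← Complex.one_re, ← hω.2, Matrix.trace, Complex.re_sum]
      exact Finset.sum_le_univ_sum_of_nonneg fun i => (Complex.nonneg_iff.1 hω.1.diag_nonneg).1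
    have hs' : 0 ≤ s := Finset.sum_nonneg fun i _ => (Complex.nonneg_iff.1 hω.1.diag_nonneg).1
    exact Real.le_sqrt_of_sq_le (by nlinarith)
  simp only [mul_sub, Finset.sum_sub_distrib, ← h_block] at h_sum
  calc _ ≤ _ := norm_sub_le_norm_sub_add_norm_sub _ _ _
    _ ≤ 2 * ‖B‖ * √s + (η + D * s) := add_le_add (norm_trace_mul_sub_le hω T B) h_sum
    _ ≤ η + (2 * ‖B‖ + D) * √s := by nlinarith

end GentleMeasurement

section StatePreparation

variable {ι κ : Type*} [Fintype ι] [Fintype κ]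

lemma kronecker_conj (V ρ : Matrix ι ι ℂ) (W σ : Matrix κ κ ℂ) :
    (V ⊗ₖ W)ᴴ * (ρ ⊗ₖ σ) * (V ⊗ₖ W) = (Vᴴ * ρ * V) ⊗ₖ (Wᴴ * σ * W) := by
  rw [Matrix.conjTranspose_kronecker, ← Matrix.mul_kronecker_mul, ← Matrix.mul_kronecker_mul]

variable [DecidableEq κ]

/-- The vector `∑ₖ √rₖ |k⟩ ⊗ |φ k⟩`. For injective `φ` it purifies the state with eigenvalues `r` by
means of the environment states `φ k`. -/
def purification (r : ι → ℝ) (φ : ι → κ) (i : ι × κ) : ℂ :=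
  if i.2 = φ i.1 then (√(r i.1) : ℂ) else 0

lemma star_purification_dotProduct_mulVec (r : ι → ℝ) (φ ψ : ι → κ) (A : Matrix ι ι ℂ)
    (g : κ → ℂ) :
    star (purification r φ) ⬝ᵥ (A ⊗ₖ Matrix.diagonal g) *ᵥ purification r ψ =
      ∑ k, ∑ k', if φ k = ψ k' then √(r k) * √(r k') * A k k' * g (φ k) else 0 := by
  simp only [dotProduct, Matrix.mulVec, Fintype.sum_prod_type, Pi.star_apply, purification,
    Matrix.kroneckerMap_apply, Matrix.diagonal_apply, apply_ite star, star_zero, ite_mul, mul_ite,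
    zero_mul, mul_zero, Finset.sum_ite_eq', Finset.mem_univ, if_true, Complex.star_def,
    Complex.conj_ofReal, Finset.mul_sum]
  refine Finset.sum_congr rfl fun k _ => ?_
  rw [Finset.sum_comm]
  refine Finset.sum_congr rfl fun k' _ => ?_
  rw [Finset.sum_eq_single_of_mem (φ k) (Finset.mem_univ _) fun y _ hy => by simp [hy]]
  simp only [if_true]
  split_ifs <;> ring

variable [DecidableEq ι]

lemma exists_unitary_col_eq {T : Set ι} {w : ι → ι → ℂ}
    (hw : ∀ i ∈ T, ∀ j ∈ T, star (w i) ⬝ᵥ w j = if i = j then 1 else 0) :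
    ∃ U ∈ Matrix.unitaryGroup ι ℂ, ∀ j ∈ T, U.col j = w j := by
  have h_orthonormal :
      Orthonormal ℂ (T.domRestrict fun i => (WithLp.toLp 2 (w i) : EuclideanSpace ℂ ι)) := by
    rw [orthonormal_iff_ite]
    rintro ⟨i, hi⟩ ⟨j, hj⟩
    rw [Set.domRestrict_apply, Set.domRestrict_apply, EuclideanSpace.inner_eq_star_dotProduct,
      dotProduct_comm, hw i hi j hj]
    simp
  obtain ⟨b, hb⟩ := h_orthonormal.exists_orthonormalBasis_extension_of_card_eq (by simp)
  refine ⟨(EuclideanSpace.basisFun ι ℂ).toBasis.toMatrix b.toBasis,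
    (EuclideanSpace.basisFun ι ℂ).toMatrix_orthonormalBasis_mem_unitary b, fun j hj => ?_⟩
  ext i
  rw [Matrix.col_apply, Module.Basis.toMatrix_apply]
  simp [hb j hj]

lemma exists_unitary_block {r : ι → ℝ} (hr : ∀ k, 0 ≤ r k) (hr_sum : ∑ k, r k = 1) {T : Finset κ}
    {φ : ι × ι → κ → κ} (hφ : Set.InjOn (Function.uncurry φ) {p | p.2 ∈ T}) :
    ∃ U ∈ Matrix.unitaryGroup (ι × κ) ℂ, ∀ (A : Matrix ι ι ℂ) (g : κ → ℂ), ∀ i j : ι × κ,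
      i.2 ∈ T → j.2 ∈ T → (Uᴴ * (A ⊗ₖ Matrix.diagonal g) * U) i j =
        if i = j then ∑ k, r k * A k k * g (φ (i.1, k) i.2) else 0 := by
  have h_block (A : Matrix ι ι ℂ) (g : κ → ℂ) (i j : ι × κ) (hi : i.2 ∈ T) (hj : j.2 ∈ T) :
      star (purification r fun k => φ (i.1, k) i.2) ⬝ᵥ (A ⊗ₖ Matrix.diagonal g) *ᵥ
        purification r (fun k => φ (j.1, k) j.2) =
          if i = j then ∑ k, r k * A k k * g (φ (i.1, k) i.2) else 0 := by
    have h_iff (k k' : ι) : φ (i.1, k) i.2 = φ (j.1, k') j.2 ↔ i = j ∧ k = k' := by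
      refine (hφ.eq_iff (x := ((i.1, k), i.2)) (y := ((j.1, k'), j.2)) hi hj).trans ?_
      simp only [Prod.ext_iff]
      tauto
    rw [star_purification_dotProduct_mulVec]
    simp only [h_iff]
    split_ifs with hij
    · simp only [hij, true_and, Finset.sum_ite_eq, Finset.mem_univ, if_true]
      refine Finset.sum_congr rfl fun k _ => ?_
      rw [← Complex.ofReal_mul, Real.mul_self_sqrt (hr k)]
    · simp [hij]
  obtain ⟨U, hU, h_col⟩ := exists_unitary_col_eq (T := {i : ι × κ | i.2 ∈ T})
    (w := fun i => purification r fun k => φ (i.1, k) i.2) fun i hi j hj => by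
      simpa [hr_sum, ← Complex.ofReal_sum] using h_block 1 1 i j hi hj
  refine ⟨U, hU, fun A g i j hi hj => ?_⟩
  rw [← h_block A g i j hi hj, ← h_col i hi, ← h_col j hj, Matrix.mul_assoc, Matrix.mul_apply]
  simp only [dotProduct, Matrix.conjTranspose_apply, Pi.star_apply, Matrix.col_apply,
    Matrix.mulVec, Matrix.mul_apply]

omit [DecidableEq κ] in
lemma IsDensity.sum_conj_kronecker_apply {ρ : Matrix ι ι ℂ} (hρ : IsDensity ρ)
    {σ : Matrix κ κ ℂ} (hσ : IsDensity σ) {V : Matrix ι ι ℂ} (hV : V ∈ Matrix.unitaryGroup ι ℂ)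
    (W : Matrix κ κ ℂ) (x : κ) :
    ∑ a, ((V ⊗ₖ W)ᴴ * (ρ ⊗ₖ σ) * (V ⊗ₖ W)) (a, x) (a, x) = population W σ x := by
  have h_trace : ∑ a, (Vᴴ * ρ * V) a a = 1 := (hρ.conjTranspose_conj hV).2
  simp only [kronecker_conj, Matrix.kroneckerMap_apply, hσ.population_eq]
  rw [← Finset.sum_mul, h_trace, one_mul]

lemma IsDensity.sum_compl_conj_kronecker_re {ρ : Matrix ι ι ℂ} (hρ : IsDensity ρ)
    {σ : Matrix κ κ ℂ} (hσ : IsDensity σ) {V : Matrix ι ι ℂ} (hV : V ∈ Matrix.unitaryGroup ι ℂ)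
    (W : Matrix κ κ ℂ) (T : Finset κ) :
    ∑ i ∈ (Finset.univ ×ˢ T)ᶜ, (((V ⊗ₖ W)ᴴ * (ρ ⊗ₖ σ) * (V ⊗ₖ W)) i i).re =
      ∑ x ∈ Tᶜ, population W σ x := by
  have h_compl : ((Finset.univ : Finset ι) ×ˢ T)ᶜ = Finset.univ ×ˢ Tᶜ := by
    ext i
    simp
  rw [h_compl, Finset.sum_product_right]
  refine Finset.sum_congr rfl fun x _ => ?_
  rw [← Complex.re_sum, hρ.sum_conj_kronecker_apply hσ hV, Complex.ofReal_re]

open scoped Matrix.Norms.L2Operator in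
lemma norm_conjTranspose_conj {U : Matrix ι ι ℂ} (hU : U ∈ Matrix.unitaryGroup ι ℂ)
    (B : Matrix ι ι ℂ) : ‖Uᴴ * B * U‖ = ‖B‖ := by
  rw [CStarRing.norm_mul_mem_unitary _ hU,
    CStarRing.norm_mem_unitary_mul _ (conjTranspose_mem_unitaryGroup hU)]

lemma conjTranspose_conj_diagonalIn {U : Matrix ι ι ℂ} (hU : U ∈ Matrix.unitaryGroup ι ℂ)
    (l : ι → ℝ) : Uᴴ * diagonalIn U l * U = Matrix.diagonal fun i => (l i : ℂ) := by
  have h_one := conjTranspose_mul_self_of_unitary hU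
  simp only [diagonalIn, mul_assoc, h_one, mul_one]
  rw [← mul_assoc, h_one, one_mul]

open scoped Matrix.Norms.L2Operator in
lemma exists_unitary_norm_trace_sub_le {V : Matrix ι ι ℂ} (hV : V ∈ Matrix.unitaryGroup ι ℂ)
    {W : Matrix κ κ ℂ} (hW : W ∈ Matrix.unitaryGroup κ ℂ) {r : ι → ℝ} (hr : ∀ k, 0 ≤ r k)
    (hr_sum : ∑ k, r k = 1) {T : Finset κ} {φ : ι × ι → κ → κ}
    (hφ : Set.InjOn (Function.uncurry φ) {p | p.2 ∈ T}) :
    ∃ U ∈ Matrix.unitaryGroup (ι × κ) ℂ, ∀ ρ, IsDensity ρ → ∀ σ, IsDensity σ →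
      ∀ (A : Matrix ι ι ℂ) (g : κ → ℝ) (c : κ → ℂ) {η D : ℝ}, 0 ≤ η → 0 ≤ D →
        (∀ a, ∀ x ∈ T, ‖∑ k, r k * (Vᴴ * A * V) k k * g (φ (a, k) x) - c x‖ ≤ η) →
        (∀ x, ‖c x‖ ≤ D) →
          ‖(jointEvolution U ρ σ * (A ⊗ₖ diagonalIn W g)).trace - ∑ x, population W σ x * c x‖ ≤
            η + (2 * ‖A ⊗ₖ diagonalIn W g‖ + D) * √(∑ x ∈ Tᶜ, population W σ x) := by
  obtain ⟨U, hU, h_block⟩ := exists_unitary_block hr hr_sum hφ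
  set X := V ⊗ₖ W
  have hX : X ∈ Matrix.unitaryGroup (ι × κ) ℂ := Matrix.kronecker_mem_unitary hV hW
  refine ⟨X * U * Xᴴ, mul_mem (mul_mem hX hU) (conjTranspose_mem_unitaryGroup hX),
    fun ρ hρ σ hσ A g c η D hη hD h_near hc => ?_⟩
  set O := A ⊗ₖ diagonalIn W g
  set ω := Xᴴ * (ρ ⊗ₖ σ) * X
  have hω : IsDensity ω := (hρ.kronecker hσ).conjTranspose_conj hX
  have hO : Xᴴ * O * X = (Vᴴ * A * V) ⊗ₖ Matrix.diagonal fun x => (g x : ℂ) := by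
    rw [kronecker_conj, conjTranspose_conj_diagonalIn hW]
  have h_trace : (jointEvolution (X * U * Xᴴ) ρ σ * O).trace =
      (ω * (Uᴴ * (Xᴴ * O * X) * U)).trace := by
    simp only [jointEvolution, Matrix.conjTranspose_mul, Matrix.conjTranspose_conjTranspose, ω,
      mul_assoc]
    rw [Matrix.trace_mul_comm X, mul_assoc U, Matrix.trace_mul_comm U]
    simp only [mul_assoc]
  have h_norm : ‖Uᴴ * (Xᴴ * O * X) * U‖ = ‖O‖ := by
    rw [norm_conjTranspose_conj hU, norm_conjTranspose_conj hX]
  have h_sum : ∑ i : ι × κ, ω i i * c i.2 = ∑ x, population W σ x * c x := by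
    rw [Fintype.sum_prod_type_right]
    simp only [← Finset.sum_mul]
    exact Finset.sum_congr rfl fun x _ => by rw [hρ.sum_conj_kronecker_apply hσ hV]
  rw [h_trace, ← h_sum, ← h_norm, ← hρ.sum_compl_conj_kronecker_re hσ hV]
  refine hω.norm_trace_mul_sub_sum_le (Finset.univ ×ˢ T) (fun i hi j hj => ?_) hη
    (fun i hi => h_near i.1 i.2 (Finset.mem_product.1 hi).2) hD fun i => hc i.2
  rw [hO, h_block _ _ i j (Finset.mem_product.1 hi).2 (Finset.mem_product.1 hj).2]

lemma trace_mul_single_kronecker_one (ω : Matrix (ι × κ) (ι × κ) ℂ) (a b : ι) :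
    (ω * (Matrix.single b a 1 ⊗ₖ (1 : Matrix κ κ ℂ))).trace = traceEnv ω a b := by
  rw [← trace_traceEnv_mul, Matrix.trace_mul_single]
  simp

open scoped Matrix.Norms.L2Operator in
lemma norm_single_kronecker_one_le (a b : ι) :
    ‖Matrix.single b a (1 : ℂ) ⊗ₖ (1 : Matrix κ κ ℂ)‖ ≤ 1 := by
  set A := Matrix.single b a (1 : ℂ) ⊗ₖ (1 : Matrix κ κ ℂ)
  have h_projection : IsStarProjection (Aᴴ * A) := by
    have h_eq : Aᴴ * A = Matrix.single a a (1 : ℂ) ⊗ₖ (1 : Matrix κ κ ℂ) := by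
      simp [A, Matrix.conjTranspose_kronecker, ← Matrix.mul_kronecker_mul]
    rw [h_eq]
    constructor
    · simp [IsIdempotentElem, ← Matrix.mul_kronecker_mul]
    · simp [IsSelfAdjoint, Matrix.star_eq_conjTranspose, Matrix.conjTranspose_kronecker]
  have h_sq : ‖A‖ * ‖A‖ ≤ 1 := by
    rw [← Matrix.l2_opNorm_conjTranspose_mul_self]
    exact h_projection.norm_le
  nlinarith [norm_nonneg A]

lemma IsDensity.exists_eq_diagonalIn {ρ : Matrix ι ι ℂ} (hρ : IsDensity ρ) :
    ∃ V ∈ Matrix.unitaryGroup ι ℂ, ∃ r : ι → ℝ, (∀ k, 0 ≤ r k) ∧ ∑ k, r k = 1 ∧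
      ρ = diagonalIn V r := by
  refine ⟨hρ.1.1.eigenvectorUnitary, hρ.1.1.eigenvectorUnitary.2, hρ.1.1.eigenvalues,
    hρ.1.eigenvalues_nonneg, ?_, hρ.1.1.spectral_theorem⟩
  exact Complex.ofReal_injective <| by
    rw [Complex.ofReal_sum]
    exact hρ.1.1.trace_eq_sum_eigenvalues.symm.trans hρ.2

lemma sum_mul_conjTranspose_conj_apply (V A : Matrix ι ι ℂ) (r : ι → ℝ) :
    ∑ k, r k * (Vᴴ * A * V) k k = (diagonalIn V r * A).trace := by
  have h_cycle : (diagonalIn V r * A).trace =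
      ((Matrix.diagonal fun k => (r k : ℂ)) * (Vᴴ * A * V)).trace := by
    simp only [diagonalIn, mul_assoc]
    rw [Matrix.trace_mul_comm V]
    simp only [mul_assoc]
  rw [h_cycle]
  simp only [Matrix.trace, Matrix.diag_apply, Matrix.diagonal_mul]

open scoped Matrix.Norms.L2Operator in
lemma norm_one_kronecker_diagonalIn_le {W : Matrix κ κ ℂ} (hW : W ∈ Matrix.unitaryGroup κ ℂ)
    {l : κ → ℝ} {C : ℝ} (hC : 0 ≤ C) (hl : ∀ x, |l x| ≤ C) :
    ‖(1 : Matrix ι ι ℂ) ⊗ₖ diagonalIn W l‖ ≤ C := by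
  have hW' : (1 : Matrix ι ι ℂ) ⊗ₖ W ∈ Matrix.unitaryGroup (ι × κ) ℂ :=
    Matrix.kronecker_mem_unitary (one_mem _) hW
  rw [← norm_conjTranspose_conj hW', kronecker_conj, conjTranspose_conj_diagonalIn hW,
    Matrix.conjTranspose_one, mul_one, mul_one, ← Matrix.diagonal_one,
    Matrix.diagonal_kronecker_diagonal, Matrix.l2_opNorm_diagonal, pi_norm_le_iff_of_nonneg hC]
  intro i
  rw [one_mul, Complex.norm_real]
  exact hl i.2

omit [DecidableEq ι] in
lemma IsDensity.norm_apply_le_one {ρ : Matrix ι ι ℂ} (hρ : IsDensity ρ) (a b : ι) :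
    ‖ρ a b‖ ≤ 1 := by
  classical
  have h_trace := trace_mul_single_kronecker_one (κ := Unit) (ρ ⊗ₖ 1) a b
  rw [traceEnv_kronecker ρ (by simp)] at h_trace
  rw [← h_trace]
  refine (IsDensity.norm_trace_mul_le ?_ _).trans (norm_single_kronecker_one_le a b)
  exact hρ.kronecker ⟨Matrix.PosSemidef.one, by simp⟩

omit [DecidableEq ι] in
lemma abs_sum_mul_sub_le {r v : ι → ℝ} (hr : ∀ k, 0 ≤ r k) (hr_sum : ∑ k, r k = 1) {c η : ℝ}
    (hv : ∀ k, |v k - c| ≤ η) : |∑ k, r k * v k - c| ≤ η :=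
  calc |∑ k, r k * v k - c| = |∑ k, r k * (v k - c)| := by
        simp only [mul_sub, Finset.sum_sub_distrib, ← Finset.sum_mul, hr_sum, one_mul]
    _ ≤ ∑ k, r k * η := by
        refine (Finset.abs_sum_le_sum_abs _ _).trans (Finset.sum_le_sum fun k _ => ?_)
        rw [abs_mul, abs_of_nonneg (hr k)]
        exact mul_le_mul_of_nonneg_left (hv k) (hr k)
    _ = η := by rw [← Finset.sum_mul, hr_sum, one_mul]

lemma exists_unitary_preparation {ρf : Matrix ι ι ℂ} (hρf : IsDensity ρf) {W : Matrix κ κ ℂ}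
    (hW : W ∈ Matrix.unitaryGroup κ ℂ) {l : κ → ℝ} {C : ℝ} (hC : 0 ≤ C) (hl : ∀ x, |l x| ≤ C)
    {T : Finset κ} {φ : ι × ι → κ → κ} (hφ : Set.InjOn (Function.uncurry φ) {p | p.2 ∈ T})
    {Δ η : ℝ} (hη : 0 ≤ η) (h_shift : ∀ p, ∀ x ∈ T, |l (φ p x) - (l x + Δ)| ≤ η) :
    ∃ U ∈ Matrix.unitaryGroup (ι × κ) ℂ, ∀ ρ, IsDensity ρ → ∀ σ, IsDensity σ →
      (∀ a b, ‖traceEnv (jointEvolution U ρ σ) a b - ρf a b‖ ≤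
        3 * √(∑ x ∈ Tᶜ, population W σ x)) ∧
      |meanEnergy (jointEvolution U ρ σ) ((1 : Matrix ι ι ℂ) ⊗ₖ diagonalIn W l) -
        meanEnergy σ (diagonalIn W l) - Δ| ≤
          η + (3 * C + |Δ|) * √(∑ x ∈ Tᶜ, population W σ x) := by
  obtain ⟨V, hV, r, hr, hr_sum, rfl⟩ := hρf.exists_eq_diagonalIn
  obtain ⟨U, hU, h_trace⟩ := exists_unitary_norm_trace_sub_le hV hW hr hr_sum hφ
  refine ⟨U, hU, fun ρ hρ σ hσ => ⟨fun a b => ?_, ?_⟩⟩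
  · have h_state := h_trace ρ hρ σ hσ (Matrix.single b a 1) 1 (fun _ => diagonalIn V r a b) le_rfl
      zero_le_one (fun _ x _ => le_of_eq ?_) fun _ => hρf.norm_apply_le_one a b
    · rw [diagonalIn_one hW, trace_mul_single_kronecker_one, ← Finset.sum_mul,
        ← Complex.ofReal_sum, hσ.sum_population hW, Complex.ofReal_one, one_mul, zero_add]
        at h_state
      refine h_state.trans (mul_le_mul_of_nonneg_right ?_ (Real.sqrt_nonneg _))
      linarith [norm_single_kronecker_one_le (κ := κ) a b]
    · simp only [Pi.one_apply, Complex.ofReal_one, mul_one]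
      rw [sum_mul_conjTranspose_conj_apply, Matrix.trace_mul_single]
      simp
  · have h_shift_sum (a : ι) (x : κ) (hx : x ∈ T) :
        ‖∑ k, r k * (Vᴴ * (1 : Matrix ι ι ℂ) * V) k k * l (φ (a, k) x) - (l x + Δ : ℝ)‖ ≤ η := by
      simp only [mul_one, conjTranspose_mul_self_of_unitary hV, Matrix.one_apply_eq,
        ← Complex.ofReal_mul, ← Complex.ofReal_sum, ← Complex.ofReal_sub, Complex.norm_real]
      exact abs_sum_mul_sub_le hr hr_sum fun k => h_shift (a, k) x hx
    have h_energy := h_trace ρ hρ σ hσ 1 l (fun x => (l x + Δ : ℝ)) hη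
      (add_nonneg hC (abs_nonneg Δ)) h_shift_sum fun x => by
        rw [Complex.norm_real]
        exact (abs_add_le _ _).trans (add_le_add_left (hl x) _)
    have h_mean : ∑ x, (population W σ x : ℂ) * (l x + Δ : ℝ) =
        (meanEnergy σ (diagonalIn W l) + Δ : ℝ) := by
      rw [meanEnergy_diagonalIn]
      simp only [← Complex.ofReal_mul, ← Complex.ofReal_sum, mul_add, Finset.sum_add_distrib,
        ← Finset.sum_mul, hσ.sum_population hW, one_mul]
    rw [h_mean] at h_energy
    have h_re := (Complex.abs_re_le_norm _).trans h_energy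
    rw [Complex.sub_re, Complex.ofReal_re, ← sub_sub] at h_re
    refine h_re.trans (add_le_add_right (mul_le_mul_of_nonneg_right ?_ (Real.sqrt_nonneg _)) _)
    linarith [norm_one_kronecker_diagonalIn_le (ι := ι) hW hC hl]

end StatePreparation

section Concentration

open MeasureTheory ProbabilityTheory

lemma sum_le_add_of_subset_union {X : Type*} [DecidableEq X] {g : X → ℝ} (hg : ∀ x, 0 ≤ g x)
    {s t u : Finset X} (h_subset : u ⊆ s ∪ t) :
    ∑ x ∈ u, g x ≤ ∑ x ∈ s, g x + ∑ x ∈ t, g x := by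
  rw [← Finset.sum_union_inter]
  exact (Finset.sum_le_sum_of_subset_of_nonneg h_subset fun x _ _ => hg x).trans
    (le_add_of_nonneg_right (Finset.sum_nonneg fun x _ => hg x))

variable {α : Type*} [Fintype α] [DecidableEq α] {A : α → Type*} [∀ i, Fintype (A i)]
  {p : ∀ i, A i → ℝ}

lemma sum_prod_apply_le_exp (hp : ∀ i a, 0 ≤ p i a) (hp_sum : ∀ i, ∑ a, p i a = 1)
    {Y : ∀ i, A i → ℝ} (hY_mean : ∀ i, ∑ a, p i a * Y i a = 0) {B : ℝ}
    (hY : ∀ i a, |Y i a| ≤ B) {t : ℝ} (ht : 0 ≤ t) :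
    ∑ x : (∀ i, A i) with t ≤ ∑ i, Y i (x i), ∏ i, p i (x i) ≤
      Real.exp (-t ^ 2 / (2 * (Fintype.card α * B ^ 2))) := by
  let (i : α) : MeasurableSpace (A i) := ⊤
  have (i : α) : DiscreteMeasurableSpace (A i) := ⟨fun _ => trivial⟩
  let P (i : α) : PMF (A i) := PMF.ofFintype (fun a => ENNReal.ofReal (p i a)) <| by
    rw [← ENNReal.ofReal_sum_of_nonneg fun a _ => hp i a, hp_sum, ENNReal.ofReal_one]
  let μ : Measure (∀ i, A i) := Measure.pi fun i => (P i).toMeasure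
  have h_singleton (x : ∀ i, A i) : μ.real {x} = ∏ i, p i (x i) := by
    simp only [μ, measureReal_def, Measure.pi_singleton, ENNReal.toReal_prod,
      PMF.toMeasure_apply_singleton _ _ (measurableSet_singleton _)]
    exact Finset.prod_congr rfl fun i _ => ENNReal.toReal_ofReal (hp i _)
  have h_mean (i : α) : ∫ x, Y i (x i) ∂μ = 0 := by
    rw [integral_comp_eval (μ := fun i => (P i).toMeasure) (f := Y i)
      (Measurable.of_discrete.aestronglyMeasurable), PMF.integral_eq_sum, ← hY_mean i]
    exact Finset.sum_congr rfl fun a _ => by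
      rw [smul_eq_mul]
      congr 1
      exact ENNReal.toReal_ofReal (hp i a)
  have h_indep : iIndepFun (fun i x => Y i (x i)) μ :=
    iIndepFun_pi fun i => Measurable.of_discrete.aemeasurable
  have h_subgaussian (i : α) : HasSubgaussianMGF (fun x => Y i (x i)) ((‖B - -B‖₊ / 2) ^ 2) μ :=
    hasSubgaussianMGF_of_mem_Icc_of_integral_eq_zero (Measurable.of_discrete.aemeasurable)
      (ae_of_all _ fun x => abs_le.1 (hY i (x i))) (h_mean i)
  have h_tail := HasSubgaussianMGF.measure_sum_ge_le_of_iIndepFun h_indep (s := Finset.univ)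
    (fun i _ => h_subgaussian i) ht
  have h_proxy : ((∑ i : α, (‖B - -B‖₊ / 2) ^ 2 : NNReal) : ℝ) = Fintype.card α * B ^ 2 := by
    simp [← two_mul]
  rw [h_proxy] at h_tail
  simp only [← h_singleton, sum_measureReal_singleton]
  simpa using h_tail

lemma sum_prod_apply_abs_le_exp (hp : ∀ i a, 0 ≤ p i a) (hp_sum : ∀ i, ∑ a, p i a = 1)
    {Y : ∀ i, A i → ℝ} (hY_mean : ∀ i, ∑ a, p i a * Y i a = 0) {B : ℝ} (hB : 0 < B)
    (hY : ∀ i a, |Y i a| ≤ B) {n : ℝ} (hn : Fintype.card α ≤ n) {t : ℝ} (ht : 0 < t) :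
    ∑ x : (∀ i, A i) with t < |∑ i, Y i (x i)|, ∏ i, p i (x i) ≤
      2 * Real.exp (-t ^ 2 / (2 * (n * B ^ 2))) := by
  classical
  have h_prod (x : ∀ i, A i) : 0 ≤ ∏ i, p i (x i) := Finset.prod_nonneg fun i _ => hp i (x i)
  rcases isEmpty_or_nonempty α with _ | _
  · simp [ht.not_gt, (Real.exp_pos _).le]
  have h_exp : Real.exp (-t ^ 2 / (2 * (Fintype.card α * B ^ 2))) ≤
      Real.exp (-t ^ 2 / (2 * (n * B ^ 2))) := by
    rw [Real.exp_le_exp, neg_div, neg_div, neg_le_neg_iff]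
    gcongr
  have h_upper := sum_prod_apply_le_exp hp hp_sum hY_mean hY ht.le
  have h_lower := sum_prod_apply_le_exp hp hp_sum (Y := fun i a => -Y i a)
    (fun i => by simpa using hY_mean i) (fun i a => (abs_neg _).trans_le (hY i a)) ht.le
  have h_subset : (Finset.univ.filter fun x : ∀ i, A i => t < |∑ i, Y i (x i)|) ⊆
      (Finset.univ.filter fun x : ∀ i, A i => t ≤ ∑ i, Y i (x i)) ∪
        Finset.univ.filter fun x : ∀ i, A i => t ≤ ∑ i, -Y i (x i) := by
    intro x
    simp only [Finset.mem_union, Finset.mem_filter_univ, Finset.sum_neg_distrib]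
    exact fun hx => (lt_abs.1 hx).imp le_of_lt le_of_lt
  linarith [sum_le_add_of_subset_union h_prod h_subset]

/-- The configurations that are typical for independent systems with levels `L i` and mean energies
`m i`: up to `t`, the total energy equals its mean, and so does the sum of the energies weighted by
the inverse temperatures `b i`, so that the Gibbs weights are almost constant on this set. -/
def typicalSet (L : ∀ i, A i → ℝ) (m b : α → ℝ) (t : ℝ) : Finset (∀ i, A i) :=
  {x | |∑ i, (L i (x i) - m i)| ≤ t ∧ |∑ i, b i * (L i (x i) - m i)| ≤ t}

variable {L : ∀ i, A i → ℝ} {m b : α → ℝ} {t : ℝ}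

lemma mem_typicalSet {x : ∀ i, A i} : x ∈ typicalSet L m b t ↔
    |∑ i, (L i (x i) - m i)| ≤ t ∧ |∑ i, b i * (L i (x i) - m i)| ≤ t :=
  Finset.mem_filter_univ x

lemma sum_prod_apply_eq_one (hp_sum : ∀ i, ∑ a, p i a = 1) :
    ∑ x : (∀ i, A i), ∏ i, p i (x i) = 1 := by
  rw [← Fintype.piFinset_univ, ← Finset.prod_univ_sum, Finset.prod_eq_one fun i _ => hp_sum i]

omit [DecidableEq α] in
lemma prod_gibbsWeight_eq_exp [∀ i, Nonempty (A i)] (L : ∀ i, A i → ℝ) (m b : α → ℝ)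
    (x : ∀ i, A i) :
    ∏ i, gibbsWeight (L i) (b i) (x i) = Real.exp
      (-∑ i, entropyBound (L i) (m i) (b i) - ∑ i, b i * (L i (x i) - m i)) := by
  rw [Finset.prod_congr rfl fun i _ => gibbsWeight_eq_exp (L i) (m i) (b i) (x i),
    ← Real.exp_sum, Finset.sum_sub_distrib, Finset.sum_neg_distrib]

lemma card_typicalSet_le [∀ i, Nonempty (A i)] (L : ∀ i, A i → ℝ) (m b : α → ℝ) (t : ℝ) :
    (typicalSet L m b t).card ≤ Real.exp (∑ i, entropyBound (L i) (m i) (b i) + t) := by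
  have h_le : (typicalSet L m b t).card • Real.exp
      (-(∑ i, entropyBound (L i) (m i) (b i) + t)) ≤ 1 := by
    rw [← sum_prod_apply_eq_one fun i => sum_gibbsWeight (L i) (b i)]
    refine (Finset.card_nsmul_le_sum _ _ _ fun x hx => ?_).trans
      (Finset.sum_le_univ_sum_of_nonneg fun x => Finset.prod_nonneg fun i _ =>
        (gibbsWeight_pos (L i) (b i) (x i)).le)
    rw [prod_gibbsWeight_eq_exp L m, Real.exp_le_exp]
    linarith [(abs_le.1 (mem_typicalSet.1 hx).2).2]
  rwa [nsmul_eq_mul, Real.exp_neg, ← div_eq_mul_inv, div_le_one (Real.exp_pos _)] at h_le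

variable [∀ i, DecidableEq (A i)]

lemma sum_compl_typicalSet_le (hp : ∀ i a, 0 ≤ p i a) (hp_sum : ∀ i, ∑ a, p i a = 1)
    (hp_mean : ∀ i, ∑ a, p i a * L i a = m i) {B : ℝ} (hB : 0 < B)
    (hL : ∀ i a, |L i a - m i| ≤ B) (hbL : ∀ i a, |b i * (L i a - m i)| ≤ B) {n : ℝ}
    (hn : Fintype.card α ≤ n) (ht : 0 < t) :
    ∑ x ∈ (typicalSet L m b t)ᶜ, ∏ i, p i (x i) ≤ 4 * Real.exp (-t ^ 2 / (2 * (n * B ^ 2))) := by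
  have h_mean (i : α) : ∑ a, p i a * (L i a - m i) = 0 := by
    simp only [mul_sub, Finset.sum_sub_distrib, ← Finset.sum_mul, hp_sum, hp_mean, one_mul,
      sub_self]
  have h_mean_weighted (i : α) : ∑ a, p i a * (b i * (L i a - m i)) = 0 := by
    simp only [mul_left_comm _ (b i), ← Finset.mul_sum, h_mean, mul_zero]
  have h_subset : (typicalSet L m b t)ᶜ ⊆
      (Finset.univ.filter fun x : ∀ i, A i => t < |∑ i, (L i (x i) - m i)|) ∪
        Finset.univ.filter fun x : ∀ i, A i => t < |∑ i, b i * (L i (x i) - m i)| := by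
    intro x
    simp only [Finset.mem_compl, mem_typicalSet, not_and_or, not_le, Finset.mem_union,
      Finset.mem_filter_univ, imp_self]
  have h_prod (x : ∀ i, A i) : 0 ≤ ∏ i, p i (x i) := Finset.prod_nonneg fun i _ => hp i (x i)
  linarith [sum_le_add_of_subset_union h_prod h_subset,
    sum_prod_apply_abs_le_exp hp hp_sum h_mean hB hL hn ht,
    sum_prod_apply_abs_le_exp hp hp_sum h_mean_weighted hB hbL hn ht]

lemma le_card_typicalSet [∀ i, Nonempty (A i)] (L : ∀ i, A i → ℝ) (m b : α → ℝ) {t : ℝ}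
    (h_tail : ∑ x ∈ (typicalSet L m b t)ᶜ, ∏ i, gibbsWeight (L i) (b i) (x i) ≤ 1 / 2) :
    Real.exp (∑ i, entropyBound (L i) (m i) (b i) - t) ≤ 2 * (typicalSet L m b t).card := by
  have h_one := sum_prod_apply_eq_one fun i => sum_gibbsWeight (L i) (b i)
  rw [← Finset.sum_add_sum_compl (typicalSet L m b t)] at h_one
  have h_le : ∑ x ∈ typicalSet L m b t, ∏ i, gibbsWeight (L i) (b i) (x i) ≤
      (typicalSet L m b t).card • Real.exp
        (-(∑ i, entropyBound (L i) (m i) (b i) - t)) := by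
    refine Finset.sum_le_card_nsmul _ _ _ fun x hx => ?_
    rw [prod_gibbsWeight_eq_exp L m, Real.exp_le_exp]
    linarith [(abs_le.1 (mem_typicalSet.1 hx).2).1]
  rw [nsmul_eq_mul, Real.exp_neg, ← div_eq_mul_inv] at h_le
  have h_half := (show (1 / 2 : ℝ) ≤ _ by linarith).trans h_le
  rw [le_div_iff₀ (Real.exp_pos _)] at h_half
  linarith

end Concentration

section Transition

variable {α : Type*} [Fintype α] {A : α → Type*} {L : ∀ i, A i → ℝ} {η : ℝ}

lemma exists_abs_sum_sub_le (hη : 0 < η) (h_low : ∀ i, ∃ a, L i a = 0)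
    (h_high : ∀ i, ∃ a, L i a = η) {R : ℝ} (hR : R ∈ Set.Icc 0 (Fintype.card α * η)) :
    ∃ x : ∀ i, A i, |∑ i, L i (x i) - R| ≤ η := by
  classical
  choose low h_zero using h_low
  choose high h_eta using h_high
  have h_floor : ⌊R / η⌋₊ ≤ Fintype.card α :=
    Nat.floor_le_of_le ((div_le_iff₀ hη).2 hR.2)
  obtain ⟨s, -, hs⟩ := Finset.exists_subset_card_eq (s := (Finset.univ : Finset α)) h_floor
  refine ⟨fun i => if i ∈ s then high i else low i, ?_⟩
  have h_sum : ∑ i, L i (if i ∈ s then high i else low i) = ⌊R / η⌋₊ * η := by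
    simp only [apply_ite (L _), h_zero, h_eta, Finset.sum_ite_mem, Finset.univ_inter,
      Finset.sum_const, hs, nsmul_eq_mul]
  have h_lower := (le_div_iff₀ hη).1 (Nat.floor_le (div_nonneg hR.1 hη.le))
  have h_upper := (div_lt_iff₀ hη).1 (Nat.lt_floor_add_one (R / η))
  rw [h_sum, abs_le]
  constructor <;> linarith

lemma sum_piEquivPiSubtypeProd_symm {p : α → Prop} [DecidablePred p]
    (y : (∀ i : {i // p i}, A i) × ∀ i : {i // ¬ p i}, A i) :
    ∑ i, L i ((Equiv.piEquivPiSubtypeProd p A).symm y i) =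
      ∑ i : {i // p i}, L i (y.1 i) + ∑ i : {i // ¬ p i}, L i (y.2 i) := by
  rw [← Fintype.sum_subtype_add_sum_subtype p]
  congr 1 <;> refine Finset.sum_congr rfl fun i _ => ?_
  · rw [Equiv.piEquivPiSubtypeProd_symm_apply, dif_pos i.2]
  · rw [Equiv.piEquivPiSubtypeProd_symm_apply, dif_neg i.2]

/-- The battery is made of the systems in `p`. The other systems take up the pairs of `J × T` as
configurations in `Y`, and the battery balances the energy up to its gap `η`. -/
lemma exists_injOn_transition {p : α → Prop} [DecidablePred p] (hη : 0 < η)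
    (h_low : ∀ i, p i → ∃ a, L i a = 0) (h_high : ∀ i, p i → ∃ a, L i a = η) {J : Type*} [Fintype J]
    {T : Finset (∀ i, A i)} {Y : Finset (∀ i : {i // ¬ p i}, A i)}
    (h_card : Fintype.card J * T.card ≤ Y.card) {Δ : ℝ}
    (h_range : ∀ x ∈ T, ∀ y ∈ Y, ∑ i, L i (x i) + Δ - ∑ i : {i // ¬ p i}, L i (y i) ∈
      Set.Icc 0 (Fintype.card {i // p i} * η)) :
    ∃ φ : J → (∀ i, A i) → ∀ i, A i, Set.InjOn (Function.uncurry φ) {q | q.2 ∈ T} ∧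
      ∀ j, ∀ x ∈ T, |∑ i, L i (φ j x i) - (∑ i, L i (x i) + Δ)| ≤ η := by
  classical
  obtain ⟨ψ⟩ : Nonempty (J × T ↪ Y) := Function.Embedding.nonempty_of_card_le <| by
    simpa using h_card
  have h_battery (j : J) (x : T) : ∃ z : ∀ i : {i // p i}, A i, |∑ i : {i // p i}, L i (z i) -
      (∑ i, L i (x.1 i) + Δ - ∑ i : {i // ¬ p i}, L i ((ψ (j, x)).1 i))| ≤ η :=
    exists_abs_sum_sub_le (L := fun i : {i // p i} => L i) hη (fun i => h_low i i.2)
      (fun i => h_high i i.2) (h_range x x.2 _ (ψ (j, x)).2)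
  choose z hz using h_battery
  let combine := (Equiv.piEquivPiSubtypeProd p A).symm
  refine ⟨fun j x => if hx : x ∈ T then combine (z j ⟨x, hx⟩, (ψ (j, ⟨x, hx⟩)).1) else x, ?_,
    fun j x hx => ?_⟩
  · rintro ⟨j, x⟩ hx ⟨k, y⟩ hy h_eq
    change x ∈ T at hx
    change y ∈ T at hy
    simp only [Function.uncurry_apply_pair, dif_pos hx, dif_pos hy] at h_eq
    have h_pair := ψ.injective (Subtype.ext (Prod.ext_iff.1 (combine.injective h_eq)).2)
    simpa [Prod.ext_iff] using h_pair
  · simp only [dif_pos hx]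
    rw [sum_piEquivPiSubtypeProd_symm]
    convert hz j ⟨x, hx⟩ using 2
    ring

end Transition

section Copies

lemma exists_kind (C : Type*) [Fintype C] (N : ℕ) :
    ∃ (n : ℕ) (kind : Fin n → C), ∀ F : C → ℝ, ∑ i, F (kind i) = N * ∑ c, F c := by
  let e : Fin (N * Fintype.card C) ≃ Fin N × C :=
    finProdFinEquiv.symm.trans ((Equiv.refl _).prodCongr (Fintype.equivFin C).symm)
  refine ⟨_, fun i => (e i).2, fun F => ?_⟩
  rw [Equiv.sum_comp e fun q => F q.2, Fintype.sum_prod_type]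
  simp

lemma exists_sum_compl_typicalSet_le {C : Type*} [Finite C] {A : C → Type*} [∀ c, Fintype (A c)]
    [∀ c, DecidableEq (A c)] (L : ∀ c, A c → ℝ) (m b : C → ℝ) {δ k : ℝ} (hδ : 0 < δ) (hk : 0 < k) :
    ∃ r > 0, ∀ {α : Type} [Fintype α] [DecidableEq α] (kind : α → C) {N : ℝ}, 0 < N →
      Fintype.card α ≤ N * k → ∀ p : ∀ i, A (kind i) → ℝ, (∀ i a, 0 ≤ p i a) →
      (∀ i, ∑ a, p i a = 1) → (∀ i, ∑ a, p i a * L (kind i) a = m (kind i)) →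
      ∑ x ∈ (typicalSet (fun i => L (kind i)) (fun i => m (kind i)) (fun i => b (kind i))
        (δ * N))ᶜ, ∏ i, p i (x i) ≤ 4 * Real.exp (-(r * N)) := by
  obtain ⟨B₀, hB₀⟩ := Finite.exists_le fun s : Σ c, A c =>
    max |L s.1 s.2 - m s.1| |b s.1 * (L s.1 s.2 - m s.1)|
  have hB : 0 < max B₀ 1 := lt_max_of_lt_right one_pos
  have h_bound (c : C) (a : A c) := max_le_iff.1 ((hB₀ ⟨c, a⟩).trans (le_max_left B₀ 1))
  refine ⟨δ ^ 2 / (2 * (k * max B₀ 1 ^ 2)), by positivity,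
    fun kind N hN h_card p hp hp_sum hp_mean => ?_⟩
  convert sum_compl_typicalSet_le (b := fun i => b (kind i)) hp hp_sum hp_mean hB
    (fun i a => (h_bound (kind i) a).1) (fun i a => (h_bound (kind i) a).2) h_card
    (mul_pos hδ hN) using 3
  field_simp

lemma tendsto_mul_sqrt_exp (K k : ℝ) {r : ℝ} (hr : 0 < r) :
    Filter.Tendsto (fun N : ℕ => K * (N * k + 1) * √(4 * Real.exp (-(r * N)))) Filter.atTop
      (nhds 0) := by
  have h_base : |Real.exp (-(r / 2))| < 1 := by
    rw [abs_of_pos (Real.exp_pos _), Real.exp_lt_one_iff]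
    linarith
  have h_sqrt (N : ℕ) : √(4 * Real.exp (-(r * N))) = 2 * Real.exp (-(r / 2)) ^ N := by
    rw [Real.sqrt_eq_iff_mul_self_eq (by positivity) (by positivity), mul_mul_mul_comm,
      ← Real.exp_nat_mul, ← Real.exp_add]
    ring_nf
  have h_linear := tendsto_pow_const_mul_const_pow_of_abs_lt_one 1 h_base
  have h_const := tendsto_pow_const_mul_const_pow_of_abs_lt_one 0 h_base
  convert ((h_linear.const_mul k).add h_const).const_mul (2 * K) using 2
  · rw [h_sqrt]
    ring
  · simp

lemma exists_large_nat (D M K k : ℝ) {δ r s ε : ℝ} (hδ : 0 < δ) (hr : 0 < r) (hs : 0 < s)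
    (hε : 0 < ε) :
    ∃ N : ℕ, 0 < N ∧ D ≤ δ * N ∧ M ≤ Real.exp (δ * N) ∧ 4 * Real.exp (-(s * N)) ≤ 1 / 2 ∧
      K * (N * k + 1) * √(4 * Real.exp (-(r * N))) ≤ ε := by
  have h_cast := tendsto_natCast_atTop_atTop (R := ℝ)
  have h_linear := h_cast.const_mul_atTop hδ
  have h_exp := Real.tendsto_exp_atTop.comp h_linear
  have h_tail := (Real.tendsto_exp_neg_atTop_nhds_zero.comp (h_cast.const_mul_atTop hs)).const_mul 4
  rw [mul_zero] at h_tail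
  exact ((Filter.eventually_gt_atTop 0).and <| (h_linear.eventually_ge_atTop D).and <|
    (h_exp.eventually_ge_atTop M).and <|
    (h_tail.eventually_le_const (one_half_pos (α := ℝ))).and <|
    (tendsto_mul_sqrt_exp K k hr).eventually_le_const hε).exists

end Copies

section LargeEnvironment

variable {ι : Type*} [Fintype ι] {A : Option ι → Type*} [∀ c, Fintype (A c)]
  {L : ∀ c, A c → ℝ} {m b : Option ι → ℝ} {β η : ℝ}

section

variable {α : Type*} [Fintype α] {kind : α → Option ι} {N : ℝ}

lemma sum_kind_ne_none (h_kind : ∀ F : Option ι → ℝ, ∑ i, F (kind i) = N * ∑ c, F c)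
    (F : Option ι → ℝ) :
    ∑ i : {i // ¬ kind i = none}, F (kind i) = N * ∑ i, F (some i) := by
  classical
  let G (c : Option ι) : ℝ := if c = none then 0 else F c
  have h_battery : ∑ i : {i // kind i = none}, G (kind i) = 0 :=
    Finset.sum_eq_zero fun i _ => if_pos i.2
  have h_total := h_kind G
  rw [← Fintype.sum_subtype_add_sum_subtype fun i => kind i = none, h_battery, zero_add,
    Fintype.sum_option] at h_total
  simpa [G] using (Finset.sum_congr rfl fun i _ => (if_neg i.2).symm).trans h_total

lemma card_kind_eq_none (h_kind : ∀ F : Option ι → ℝ, ∑ i, F (kind i) = N * ∑ c, F c) :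
    (Fintype.card {i // kind i = none} : ℝ) = N := by
  have h_total := h_kind fun _ => 1
  rw [← Fintype.sum_subtype_add_sum_subtype fun i => kind i = none,
    sum_kind_ne_none h_kind fun _ => 1, Fintype.sum_option, mul_add, add_left_inj] at h_total
  simpa using h_total

lemma IsResource.exists_injOn_kind (h : IsResource L m b β η) (hη : 0 < η)
    {J : Type*} [Fintype J] {T : Finset (∀ i, A (kind i))}
    {Y : Finset (∀ i : {i // ¬ kind i = none}, A (kind i))}
    (h_card : Fintype.card J * T.card ≤ Y.card) {Δ : ℝ}
    (h_range : ∀ x ∈ T, ∀ y ∈ Y,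
      ∑ i, L (kind i) (x i) + Δ - ∑ i : {i // ¬ kind i = none}, L (kind i) (y i) ∈
        Set.Icc 0 (Fintype.card {i // kind i = none} * η)) :
    ∃ φ : J → (∀ i, A (kind i)) → ∀ i, A (kind i), Set.InjOn (Function.uncurry φ) {q | q.2 ∈ T} ∧
      ∀ j, ∀ x ∈ T, |∑ i, L (kind i) (φ j x i) - (∑ i, L (kind i) (x i) + Δ)| ≤ η := by
  have h_low (i : α) (hi : kind i = none) : ∃ a, L (kind i) a = 0 := by
    rw [hi]
    exact h.exists_low
  have h_high (i : α) (hi : kind i = none) : ∃ a, L (kind i) a = η := by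
    rw [hi]
    exact h.exists_high
  exact exists_injOn_transition hη h_low h_high h_card h_range

variable [DecidableEq α]

lemma sum_sub_sum_mem_Icc_of_mem_typicalSet
    (h_kind : ∀ F : Option ι → ℝ, ∑ i, F (kind i) = N * ∑ c, F c) {δ : ℝ} {m' : Option ι → ℝ}
    (h_energy : ∑ i, m' (some i) + 3 * δ ≤ ∑ c, m c)
    (h_energy' : ∑ c, m c + 3 * δ ≤ ∑ i, m' (some i) + η)
    (hN : 0 ≤ N) {Δ : ℝ} (hΔ : |Δ| ≤ δ * N) {b : α → ℝ} {b' : {i // ¬ kind i = none} → ℝ}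
    {x : ∀ i, A (kind i)} {y : ∀ i : {i // ¬ kind i = none}, A (kind i)}
    (hx : x ∈ typicalSet (fun i => L (kind i)) (fun i => m (kind i)) b (δ * N))
    (hy : y ∈ typicalSet (fun i : {i // ¬ kind i = none} => L (kind i))
      (fun i => m' (kind i)) b' (δ * N)) :
    ∑ i, L (kind i) (x i) + Δ - ∑ i : {i // ¬ kind i = none}, L (kind i) (y i) ∈
      Set.Icc 0 (Fintype.card {i // kind i = none} * η) := by
  have h_source := abs_le.1 (mem_typicalSet.1 hx).1
  have h_target := abs_le.1 (mem_typicalSet.1 hy).1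
  rw [Finset.sum_sub_distrib, h_kind] at h_source
  rw [Finset.sum_sub_distrib, sum_kind_ne_none h_kind] at h_target
  rw [card_kind_eq_none h_kind, Set.mem_Icc]
  have h_lower := mul_le_mul_of_nonneg_left h_energy hN
  have h_upper := mul_le_mul_of_nonneg_left h_energy' hN
  constructor <;> linarith [abs_le.1 hΔ]

variable [∀ c, DecidableEq (A c)] [∀ c, Nonempty (A c)]

lemma card_mul_card_typicalSet_le
    (h_kind : ∀ F : Option ι → ℝ, ∑ i, F (kind i) = N * ∑ c, F c) {δ : ℝ}
    (h_entropy : ∑ c, entropyBound (L c) (m c) (b c) + 3 * δ ≤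
      ∑ i, entropyBound (L (some i)) (gibbsEnergy (L (some i)) β) β)
    (h_tail : ∑ y ∈ (typicalSet (fun i : {i // ¬ kind i = none} => L (kind i))
      (fun i => gibbsEnergy (L (kind i)) β) (fun _ => β) (δ * N))ᶜ,
        ∏ i : {i // ¬ kind i = none}, gibbsWeight (L (kind i)) β (y i) ≤ 1 / 2)
    (hN : 0 ≤ N) {J : Type*} [Fintype J] (hJ : 2 * Fintype.card J ≤ Real.exp (δ * N)) :
    Fintype.card J * (typicalSet (fun i => L (kind i)) (fun i => m (kind i))
      (fun i => b (kind i)) (δ * N)).card ≤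
    (typicalSet (fun i : {i // ¬ kind i = none} => L (kind i))
      (fun i => gibbsEnergy (L (kind i)) β) (fun _ => β) (δ * N)).card := by
  have h_source := card_typicalSet_le (fun i => L (kind i)) (fun i => m (kind i))
    (fun i => b (kind i)) (δ * N)
  have h_target := le_card_typicalSet _ _ _ h_tail
  rw [h_kind fun c => entropyBound (L c) (m c) (b c)] at h_source
  rw [sum_kind_ne_none h_kind fun c => entropyBound (L c) (gibbsEnergy (L c) β) β] at h_target
  have h_exp := Real.exp_le_exp.2 (show δ * N + (N * ∑ c, entropyBound (L c) (m c) (b c) + δ * N) ≤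
    N * ∑ i, entropyBound (L (some i)) (gibbsEnergy (L (some i)) β) β - δ * N by
      linarith [mul_le_mul_of_nonneg_left h_entropy hN])
  rw [Real.exp_add] at h_exp
  have h_prod := mul_le_mul hJ h_source (Nat.cast_nonneg _) (Real.exp_pos _).le
  have h_card := (h_prod.trans h_exp).trans h_target
  rw [mul_assoc] at h_card
  exact_mod_cast le_of_mul_le_mul_left h_card two_pos

end

lemma IsResource.exists_margin (h : IsResource L m b β η) : ∃ δ > 0,
    ∑ c, entropyBound (L c) (m c) (b c) + 3 * δ ≤
      ∑ i, entropyBound (L (some i)) (gibbsEnergy (L (some i)) β) β ∧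
    ∑ i, gibbsEnergy (L (some i)) β + 3 * δ ≤ ∑ c, m c ∧
    ∑ c, m c + 3 * δ ≤ ∑ i, gibbsEnergy (L (some i)) β + η := by
  obtain ⟨δ, hδ, hδ_lt⟩ := exists_between (lt_min (sub_pos.2 h.entropyBound_lt)
    (lt_min (sub_pos.2 h.energy_lt) (sub_pos.2 h.lt_energy)))
  obtain ⟨h_entropy, h_energy⟩ := lt_min_iff.1 hδ_lt
  obtain ⟨h_lower, h_upper⟩ := lt_min_iff.1 h_energy
  exact ⟨δ / 3, by positivity, by linarith, by linarith, by linarith⟩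

variable [∀ c, DecidableEq (A c)] [∀ c, Nonempty (A c)]

lemma IsResource.exists_transition (h : IsResource L m b β η) (hη : 0 < η) (J : Type*) [Finite J]
    (Δ : ℝ) {K : ℝ} (hK : 0 ≤ K) {ε : ℝ} (hε : 0 < ε) :
    ∃ (n : ℕ) (kind : Fin n → Option ι) (T : Finset (∀ i, A (kind i)))
      (φ : J → (∀ i, A (kind i)) → ∀ i, A (kind i)),
      Set.InjOn (Function.uncurry φ) {q | q.2 ∈ T} ∧
      (∀ j, ∀ x ∈ T, |∑ i, L (kind i) (φ j x i) - (∑ i, L (kind i) (x i) + Δ)| ≤ η) ∧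
      ∀ p : ∀ i, A (kind i) → ℝ, (∀ i a, 0 ≤ p i a) → (∀ i, ∑ a, p i a = 1) →
        (∀ i, ∑ a, p i a * L (kind i) a = m (kind i)) →
        K * (n + 1) * √(∑ x ∈ Tᶜ, ∏ i, p i (x i)) ≤ ε := by
  cases nonempty_fintype J
  obtain ⟨δ, hδ, h_entropy, h_lower, h_upper⟩ := h.exists_margin
  have h_kinds : (0 : ℝ) < Fintype.card (Option ι) := by exact_mod_cast Fintype.card_pos
  obtain ⟨r, hr, h_source⟩ := exists_sum_compl_typicalSet_le L m b hδ h_kinds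
  obtain ⟨s, hs, h_target⟩ := exists_sum_compl_typicalSet_le L (fun c => gibbsEnergy (L c) β)
    (fun _ => β) hδ h_kinds
  obtain ⟨N, hN, hΔ, hJ, h_half, h_error⟩ := exists_large_nat |Δ| (2 * Fintype.card J) K
    (Fintype.card (Option ι)) hδ hr hs hε
  have hN_pos : (0 : ℝ) < N := Nat.cast_pos.2 hN
  obtain ⟨n, kind, h_kind⟩ := exists_kind (Option ι) N
  have h_count : (n : ℝ) = N * Fintype.card (Option ι) := by simpa using h_kind fun _ => 1
  have h_gibbs := (h_target (fun i : {i // ¬ kind i = none} => kind i) hN_pos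
    ((Nat.cast_le.2 ((Fintype.card_subtype_le _).trans (Fintype.card_fin n).le)).trans h_count.le) _
    (fun i a => (gibbsWeight_pos (L (kind i)) β a).le) (fun i => sum_gibbsWeight _ _)
    (fun i => rfl)).trans h_half
  have h_card := card_mul_card_typicalSet_le h_kind h_entropy h_gibbs hN_pos.le hJ
  obtain ⟨φ, h_inj, h_shift⟩ := h.exists_injOn_kind hη h_card fun x hx y hy =>
    sum_sub_sum_mem_Icc_of_mem_typicalSet (m' := fun c => gibbsEnergy (L c) β) h_kind h_lower
      h_upper hN_pos.le hΔ hx hy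
  refine ⟨_, kind, _, φ, h_inj, h_shift, fun p hp hp_sum hp_mean => le_trans ?_ h_error⟩
  rw [← h_count]
  gcongr
  exact h_source kind hN_pos (by rw [Fintype.card_fin, h_count]) p hp hp_sum hp_mean

end LargeEnvironment

section NonThermal

lemma sum_population_eigenbasis_mul_levels {H : Hamiltonian} {e : ℝ}
    {ρ : Matrix (Fin H.dim) (Fin H.dim) ℂ} (hρ : ρ ∈ microstates e H) :
    ∑ a, population H.eigenbasis ρ a * H.levels a = e := by
  rw [← meanEnergy_diagonalIn, ← H.op_eq_diagonalIn, hρ.2]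

lemma sum_compl_population_envBasis {N : ℕ} {E : Fin N → Hamiltonian}
    {σ : ∀ i, Matrix (Fin (E i).dim) (Fin (E i).dim) ℂ} (hσ : ∀ i, IsDensity (σ i))
    (T : Finset (EnvIdx E)) :
    ∑ x ∈ Tᶜ, population (envBasis E) (tensor σ) x =
      ∑ x ∈ Tᶜ, ∏ i, population (E i).eigenbasis (σ i) (x i) :=
  Finset.sum_congr rfl fun x _ => population_tensor _ hσ x

lemma abs_envEnergy_le {N : ℕ} {E : Fin N → Hamiltonian} {B : ℝ}
    (hB : ∀ i a, |(E i).levels a| ≤ B) (x : EnvIdx E) : |envEnergy E x| ≤ N * B := by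
  refine (Finset.abs_sum_le_sum_abs _ _).trans
    ((Finset.sum_le_card_nsmul _ _ _ fun i _ => hB i (x i)).trans_eq ?_)
  rw [Finset.card_univ, Fintype.card_fin, nsmul_eq_mul]

variable {f : Hamiltonian → ℝ}

lemma exists_environment (hf : ∀ K, (microstates (f K) K).Nonempty)
    (h_nonthermal : ¬ ∃ β : EReal, ∀ K, f K = thermalEnergy β K) {ι : Type*} [Fintype ι]
    [DecidableEq ι] {ρf : Matrix ι ι ℂ} (hρf : IsDensity ρf) (Δ : ℝ) {ε : ℝ} (hε : 0 < ε) :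
    ∃ (N : ℕ) (E : Fin N → Hamiltonian), ∃ U ∈ Matrix.unitaryGroup (ι × EnvIdx E) ℂ,
      ∀ ρ, IsDensity ρ → ∀ σ : ∀ i, Matrix (Fin (E i).dim) (Fin (E i).dim) ℂ,
        (∀ i, σ i ∈ microstates (f (E i)) (E i)) →
          (∀ a b, ‖traceEnv (jointEvolution U ρ (tensor σ)) a b - ρf a b‖ ≤ ε) ∧
          |absorbedEnergy E U ρ (tensor σ) - Δ| ≤ ε := by
  obtain ⟨w, cell, b, β, h_resource⟩ := exists_isResource hf h_nonthermal (half_pos hε)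
  obtain ⟨B, hB⟩ := Finite.exists_le fun s : Σ c, Fin (cell c).dim => |(cell s.1).levels s.2|
  have hB_nonneg : 0 ≤ B := (abs_nonneg _).trans (hB ⟨none, Classical.arbitrary _⟩)
  obtain ⟨N, kind, T, φ, h_inj, h_shift, h_tail⟩ := h_resource.exists_transition (half_pos hε)
    (ι × ι) Δ (K := 3 + 3 * B + |Δ|) (by positivity) (half_pos hε)
  let E (i : Fin N) : Hamiltonian := cell (kind i)
  obtain ⟨U, hU, h_prepare⟩ := exists_unitary_preparation hρf (envBasis_mem_unitaryGroup E)
    (by positivity) (abs_envEnergy_le fun i a => hB ⟨kind i, a⟩) h_inj (half_pos hε).le h_shift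
  refine ⟨N, E, U, hU, fun ρ hρ σ hσ => ?_⟩
  have hσ_density (i : Fin N) : IsDensity (σ i) := (hσ i).1
  obtain ⟨h_state, h_energy⟩ := h_prepare ρ hρ _ (IsDensity.tensor hσ_density)
  have h_error := h_tail (fun i => population (E i).eigenbasis (σ i))
    (fun i => (hσ_density i).population_nonneg _)
    (fun i => (hσ_density i).sum_population (E i).eigenbasis_mem_unitaryGroup)
    fun i => sum_population_eigenbasis_mul_levels (hσ i)
  rw [← sum_compl_population_envBasis hσ_density T] at h_error
  set r := √(∑ x ∈ Tᶜ, population (envBasis E) (tensor σ) x)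
  have hr : 0 ≤ r := Real.sqrt_nonneg _
  have hN : (0 : ℝ) ≤ N := Nat.cast_nonneg N
  rw [absorbedEnergy, envHamiltonian_eq_diagonalIn]
  refine ⟨fun a b => (h_state a b).trans ?_, h_energy.trans ?_⟩
  · have h_constant : 3 ≤ (3 + 3 * B + |Δ|) * (N + 1) := by nlinarith [abs_nonneg Δ]
    linarith [mul_le_mul_of_nonneg_right h_constant hr]
  · have h_constant : 3 * (N * B) + |Δ| ≤ (3 + 3 * B + |Δ|) * (N + 1) := by
      nlinarith [mul_nonneg (abs_nonneg Δ) hN]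
    linarith [mul_le_mul_of_nonneg_right h_constant hr]

theorem everyTransitionPossible_of_not_thermal (hf : ∀ K, (microstates (f K) K).Nonempty)
    (h_nonthermal : ¬ ∃ β : EReal, ∀ K, f K = thermalEnergy β K) : EveryTransitionPossible f := by
  intro e S ρf hρf ε hε ε' hε'
  set s : ℝ := ∑ a, ∑ b, ‖S.op b a‖
  set d : ℝ := (Fintype.card (Fin S.dim) : ℝ) ^ 2
  have hs : 0 < s + 1 := by positivity
  have hd : 0 < d + 1 := by positivity
  obtain ⟨δ, hδ, h_le⟩ : ∃ δ > 0, δ ≤ min (ε / (d + 1)) (ε' / (s + 1)) :=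
    ⟨_, lt_min (div_pos hε hd) (div_pos hε' hs), le_rfl⟩
  obtain ⟨hδ_state, hδ_energy⟩ := le_min_iff.1 h_le
  rw [le_div_iff₀ hd] at hδ_state
  rw [le_div_iff₀ hs] at hδ_energy
  obtain ⟨N, E, U, hU, h_env⟩ := exists_environment hf h_nonthermal hρf
    (e - meanEnergy ρf S.op) hδ
  refine ⟨N, E, U, hU, fun ρ hρ σ hσ => ?_⟩
  obtain ⟨h_state, h_absorbed⟩ := h_env ρ hρ.1 σ hσ
  have h_system := abs_meanEnergy_le (H := S.op)
    (A := traceEnv (jointEvolution U ρ (tensor σ)) - ρf) h_state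
  rw [meanEnergy_sub] at h_system
  refine ⟨(traceNorm_le hδ.le h_state).trans (by linarith), ?_⟩
  have h_balance := meanEnergy_jointEvolution_sub U hρ.1 (IsDensity.tensor fun i => (hσ i).1)
  rw [hρ.2] at h_balance
  refine (congrArg _ h_balance).trans_le ((abs_le.2 ⟨?_, ?_⟩).trans (by linarith : δ * s + δ ≤ ε'))
  all_goals linarith [abs_le.1 h_system, abs_le.1 h_absorbed]

lemma meanEnergy_submatrix_punitProd {κ : Type*} [Fintype κ]
    (U : Matrix (Unit × κ) (Unit × κ) ℂ) (σ H : Matrix κ κ ℂ) :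
    meanEnergy (U.submatrix (Equiv.punitProd κ).symm (Equiv.punitProd κ).symm * σ *
        (U.submatrix (Equiv.punitProd κ).symm (Equiv.punitProd κ).symm)ᴴ) H =
      meanEnergy (jointEvolution U 1 σ) ((1 : Matrix Unit Unit ℂ) ⊗ₖ H) := by
  have h_reindex (A : Matrix κ κ ℂ) :
      A = ((1 : Matrix Unit Unit ℂ) ⊗ₖ A).submatrix (Equiv.punitProd κ).symm
        (Equiv.punitProd κ).symm := by
    ext x y
    simp
  rw [meanEnergy, h_reindex σ, h_reindex H, Matrix.conjTranspose_submatrix,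
    Matrix.submatrix_mul_equiv, Matrix.submatrix_mul_equiv, Matrix.submatrix_mul_equiv,
    ← h_reindex, ← h_reindex]
  exact congrArg Complex.re (Equiv.sum_comp (Equiv.punitProd κ).symm fun i =>
    (jointEvolution U 1 σ * (1 : Matrix Unit Unit ℂ) ⊗ₖ H) i i)

theorem workExtractable_of_not_thermal (hf : ∀ K, (microstates (f K) K).Nonempty)
    (h_nonthermal : ¬ ∃ β : EReal, ∀ K, f K = thermalEnergy β K) (W : ℝ) :
    WorkExtractable f W := by
  have h_trivial : IsDensity (1 : Matrix Unit Unit ℂ) := ⟨Matrix.PosSemidef.one, by simp⟩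
  obtain ⟨N, E, U, hU, h_env⟩ := exists_environment hf h_nonthermal h_trivial (-(W + 1)) one_pos
  refine ⟨N, E, U.submatrix (Equiv.punitProd _).symm (Equiv.punitProd _).symm, ?_, fun σ hσ => ?_⟩
  · rw [Matrix.mem_unitaryGroup_iff, Matrix.star_eq_conjTranspose, Matrix.conjTranspose_submatrix,
      Matrix.submatrix_mul_equiv, mul_conjTranspose_self_of_unitary hU, Matrix.submatrix_one_equiv]
  · have h_absorbed := (abs_le.1 (h_env 1 h_trivial σ hσ).2).2
    rw [absorbedEnergy] at h_absorbed
    rw [meanEnergy_submatrix_punitProd]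
    linarith

end NonThermal

end Thermo

end

theorem mainTheorem6 (f : Thermo.Hamiltonian → ℝ)
    (hf : ∀ H, (Thermo.microstates (f H) H).Nonempty) :
    ((¬ ∃ β : EReal, ∀ H, f H = Thermo.thermalEnergy β H) →
      (∀ W : ℝ, Thermo.WorkExtractable f W) ∧ Thermo.EveryTransitionPossible f) ∧
    (∀ β : EReal, (∀ H, f H = Thermo.thermalEnergy β H) →
      ¬ Thermo.EveryTransitionPossible f ∧
      (0 ≤ β → ∀ W : ℝ, 0 < W → ¬ Thermo.WorkExtractable f W)) :=
  ⟨fun h_nonthermal => ⟨Thermo.workExtractable_of_not_thermal hf h_nonthermal,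
    Thermo.everyTransitionPossible_of_not_thermal hf h_nonthermal⟩,
  fun _ h_thermal => ⟨Thermo.not_everyTransitionPossible_of_thermal hf h_thermal,
    fun hβ _ hW => Thermo.not_workExtractable_of_thermal hf h_thermal hβ hW⟩⟩
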